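/- Let $\Theta\subseteq\mathbb R^m$ be open and let $\mathcal M=\{\rho(\theta)\mid\theta\in\Theta\}$ be a model of positive definite complex $n\times n$ matrices of trace $1$, with $\theta\mapsto\rho(\theta)$ of class $C^2$. For a positive definite $\rho$ and a Hermitian $X$, the symmetrized logarithmic derivative (SLD) is the unique Hermitian $L$ with $X=\frac12(L\rho+\rho L)$. Let $L^S_i(\theta)$ be the SLD of $\partial_i\rho(\theta)$ at $\rho(\theta)$, and let $$F_{ij}=(\partial_iL^S_j-\partial_jL^S_i)-\tfrac12[L^S_i,L^S_j].$$ The model is locally quasi-classical at $\theta$ if $L^S_i(\theta)$ and $L^S_j(\theta)$ commute for all $i,j$. A loop in $\Theta$ is a continuous, piecewise $C^1$ curve $\gamma:[0,1]\to\Theta$ with $\gamma(0)=\gamma(1)$. A horizontal lift of $\sigma(t)=\rho(\gamma(t))$ is a continuous matrix-valued curve $W(t)$, $0\le t\le1$, with $\sigma(t)=W(t)W(t)^\dagger$ for all $t$ and $\frac{dW}{dt}=\frac12L(t)W(t)$ for all but finitely many $t$, where $L(t)$ is the SLD of $d\sigma/dt$ at $\sigma(t)$. Its relative phase factor (RPF)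 is the unitary $U$ with $W(1)=\hat WU$, where $\hat W\hat W^\dagger=\sigma(1)$ and $\hat W^\dagger W(0)$ is Hermitian and positive definite. The RPF along $\gamma$ vanishes if $U=I$ for every horizontal lift. Then: 1. For every $\theta\in\Theta$, $\mathcal M$ is locally quasi-classical at $\theta$ if and only if $F_{ij}(\theta)=0$ for all $i,j$. 2. If $\Theta$ is simply connected, then $\mathcal M$ is locally quasi-classical at every $\theta\in\Theta$ if and only if the RPF vanishes along every loop in $\Theta$. 3. For an arbitrary open $\Theta$, $\mathcal M$ is locally quasi-classical at every $\theta\in\Theta$ if and only if the RPF vanishes along every loop in $\Theta$ that is null-homotopic in $\Theta$. -/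

import Mathlib

open scoped Matrix ComplexOrder Matrix.Norms.Operator

noncomputable section

namespace QuantumEstimation

/-- `L` is a symmetrized logarithmic derivative (SLD) at the state `ρ` for the tangent
matrix `X`: a Hermitian solution of `X = (1/2) (L ρ + ρ L)`. -/
def IsSLD {n : ℕ} (ρ X L : Matrix (Fin n) (Fin n) ℂ) : Prop :=
  L.IsHermitian ∧ X = (1 / 2 : ℂ) • (L * ρ + ρ * L)

/-- Over a positive definite state the homogeneous equation `L ρ + ρ L = 0` forces `L = 0`. -/
theorem eq_zero_of_anticomm {n : ℕ} {ρ L : Matrix (Fin n) (Fin n) ℂ} (hρ : ρ.PosDef)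
    (h : L * ρ + ρ * L = 0) : L = 0 := by
  have h1 : (L * ρ * Lᴴ).PosSemidef := hρ.posSemidef.mul_mul_conjTranspose_same L
  have h2 : (Lᴴ * ρ * L).PosSemidef := hρ.posSemidef.conjTranspose_mul_mul_same L
  have h3 : (L * ρ * Lᴴ).trace + (Lᴴ * ρ * L).trace = 0 := by
    have := congrArg Matrix.trace (congrArg (fun Z => Lᴴ * Z) h)
    simp only [mul_add, Matrix.trace_add, mul_zero, Matrix.trace_zero] at this
    rw [Matrix.trace_mul_comm (L * ρ) Lᴴ, Matrix.mul_assoc Lᴴ ρ L]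
    exact this
  have h4 : (Lᴴ * ρ * L).trace = 0 :=
    ((add_eq_zero_iff_of_nonneg h1.trace_nonneg h2.trace_nonneg).1 h3).2
  have h5 : Lᴴ * ρ * L = 0 := h2.trace_eq_zero_iff.1 h4
  by_contra hL
  obtain ⟨v, hv⟩ : ∃ v, L *ᵥ v ≠ 0 := by
    by_contra! hall
    exact hL (Matrix.ext_of_mulVec_single fun i => by rw [hall, Matrix.zero_mulVec])
  have h6 := hρ.dotProduct_mulVec_pos hv
  have h7 : star (L *ᵥ v) ⬝ᵥ (ρ *ᵥ (L *ᵥ v)) = star v ⬝ᵥ ((Lᴴ * ρ * L) *ᵥ v) := by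
    rw [Matrix.star_mulVec, Matrix.dotProduct_mulVec, Matrix.dotProduct_mulVec,
      Matrix.dotProduct_mulVec, Matrix.vecMul_vecMul, Matrix.vecMul_vecMul]
    simp [Matrix.mul_assoc]
  rw [h7, h5] at h6
  simp at h6

/-- Over a positive definite state the SLD of a Hermitian tangent matrix exists and is unique. -/
theorem existsUnique_isSLD {n : ℕ} {ρ X : Matrix (Fin n) (Fin n) ℂ} (hρ : ρ.PosDef)
    (hX : X.IsHermitian) : ∃! L, IsSLD ρ X L := by
  let T : Matrix (Fin n) (Fin n) ℂ →ₗ[ℂ] Matrix (Fin n) (Fin n) ℂ :=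
    { toFun := fun L => (1 / 2 : ℂ) • (L * ρ + ρ * L)
      map_add' := fun A B => by
        rw [← smul_add]; congr 1; noncomm_ring
      map_smul' := fun c A => by
        simp only [Matrix.smul_mul, Matrix.mul_smul, RingHom.id_apply]
        rw [← smul_add, smul_comm] }
  have hT : Function.Injective T := by
    rw [injective_iff_map_eq_zero]
    intro L hL
    refine eq_zero_of_anticomm hρ ?_
    have : (1 / 2 : ℂ) • (L * ρ + ρ * L) = 0 := hL
    exact (smul_eq_zero.1 this).resolve_left (by norm_num)
  obtain ⟨L, hL⟩ := (LinearMap.injective_iff_surjective.1 hT) X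
  have hstar : T Lᴴ = X := by
    have h := congrArg Matrix.conjTranspose hL
    rw [hX.eq] at h
    rw [← h]
    show (1 / 2 : ℂ) • (Lᴴ * ρ + ρ * Lᴴ) = ((1 / 2 : ℂ) • (L * ρ + ρ * L))ᴴ
    rw [Matrix.conjTranspose_smul, Matrix.conjTranspose_add, Matrix.conjTranspose_mul,
      Matrix.conjTranspose_mul, hρ.isHermitian.eq, add_comm]
    simp
  exact ⟨L, ⟨hT (hstar.trans hL.symm), hL.symm⟩, fun L' h' => hT (h'.2.symm.trans hL.symm)⟩

open Classical in
/-- The SLD at the state `ρ` for the tangent matrix `X` (`0` if there is none; for positive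
definite `ρ` and Hermitian `X` it exists and is unique, see `existsUnique_isSLD`). -/
def sld {n : ℕ} (ρ X : Matrix (Fin n) (Fin n) ℂ) : Matrix (Fin n) (Fin n) ℂ :=
  if h : ∃ L, IsSLD ρ X L then h.choose else 0

theorem isSLD_sld {n : ℕ} {ρ X : Matrix (Fin n) (Fin n) ℂ} (hρ : ρ.PosDef)
    (hX : X.IsHermitian) : IsSLD ρ X (sld ρ X) := by
  have h : ∃ L, IsSLD ρ X L := (existsUnique_isSLD hρ hX).exists
  rw [sld, dif_pos h]
  exact h.choose_spec

/-- A horizontal lift over `[0, 1]` of the (piecewise differentiable) curve of states `σ`: a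
continuous curve `W` with `σ(t) = W(t) W(t)†` and `dW/dt = (1/2) L(t) W(t)` away from finitely
many times, where `L(t)` is the SLD of `dσ/dt` at `σ(t)`. -/
structure IsHorizontalLift {n : ℕ} (σ W : ℝ → Matrix (Fin n) (Fin n) ℂ) : Prop where
  continuousOn : ContinuousOn W (Set.Icc 0 1)
  lift : ∀ t ∈ Set.Icc (0 : ℝ) 1, σ t = W t * (W t)ᴴ
  horizontal : ∃ S : Finset ℝ, ∀ t ∈ Set.Ioo (0 : ℝ) 1, t ∉ S →
    HasDerivAt W ((1 / 2 : ℂ) • (sld (σ t) (deriv σ t) * W t)) t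

/-- `U` is the relative phase factor between the initial point `W₀` and the final point `W₁` of
a horizontal lift: `U` is unitary and `W₁ = Ŵ U`, where `Ŵ` lies over the same state as `W₁` and
is in phase with `W₀`, i.e. `Ŵ† W₀` is Hermitian and positive definite. -/
def IsRelativePhaseFactor {n : ℕ} (W₀ W₁ U : Matrix (Fin n) (Fin n) ℂ) : Prop :=
  U ∈ Matrix.unitaryGroup (Fin n) ℂ ∧
    ∃ V : Matrix (Fin n) (Fin n) ℂ, V * Vᴴ = W₁ * W₁ᴴ ∧ (Vᴴ * W₀).PosDef ∧ W₁ = V * U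

/-- There is at most one relative phase factor. -/
theorem IsRelativePhaseFactor.unique {n : ℕ} {W₀ W₁ U U' : Matrix (Fin n) (Fin n) ℂ}
    (h : IsRelativePhaseFactor W₀ W₁ U) (h' : IsRelativePhaseFactor W₀ W₁ U') : U = U' := by
  obtain ⟨hU, V, -, hP, hV⟩ := h
  obtain ⟨hU', V', -, hP', hV'⟩ := h'
  have e : W₁ᴴ * W₀ = Uᴴ * (Vᴴ * W₀) := by
    rw [hV, Matrix.conjTranspose_mul, Matrix.mul_assoc]
  have e' : W₁ᴴ * W₀ = U'ᴴ * (V'ᴴ * W₀) := by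
    rw [hV', Matrix.conjTranspose_mul, Matrix.mul_assoc]
  generalize Vᴴ * W₀ = P at hP e
  generalize V'ᴴ * W₀ = P' at hP' e'
  have u : U * Uᴴ = 1 := (Matrix.mem_unitaryGroup_iff).1 hU
  have u' : U' * U'ᴴ = 1 := (Matrix.mem_unitaryGroup_iff).1 hU'
  have q : (W₁ᴴ * W₀)ᴴ * (W₁ᴴ * W₀) = P * P := by
    rw [e, Matrix.conjTranspose_mul, hP.isHermitian.eq, Matrix.conjTranspose_conjTranspose,
      Matrix.mul_assoc, ← Matrix.mul_assoc U, u, Matrix.one_mul]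
  have q' : (W₁ᴴ * W₀)ᴴ * (W₁ᴴ * W₀) = P' * P' := by
    rw [e', Matrix.conjTranspose_mul, hP'.isHermitian.eq, Matrix.conjTranspose_conjTranspose,
      Matrix.mul_assoc, ← Matrix.mul_assoc U', u', Matrix.one_mul]
  have hPP : P - P' = 0 := by
    refine eq_zero_of_anticomm (hP.add hP') ?_
    have : (P - P') * (P + P') + (P + P') * (P - P') = 2 • (P * P - P' * P') := by noncomm_ring
    rw [this, ← q, q', sub_self, smul_zero]
  have hE : P = P' := sub_eq_zero.1 hPP
  subst hE
  have h3 : Uᴴ = U'ᴴ := hP.isUnit.mul_left_injective (e.symm.trans e')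
  exact Matrix.conjTranspose_injective h3

/-- The relative phase factor along the curve of states `σ` over `[0, 1]` vanishes: it is the
identity matrix, for every horizontal lift of `σ`. -/
def RelativePhaseFactorVanishes {n : ℕ} (σ : ℝ → Matrix (Fin n) (Fin n) ℂ) : Prop :=
  ∀ W : ℝ → Matrix (Fin n) (Fin n) ℂ, IsHorizontalLift σ W →
    IsRelativePhaseFactor (W 0) (W 1) 1

/-- A curve `c` is piecewise continuously differentiable on `[0, 1]`: there is a partition
`0 = t₀ ≤ t₁ ≤ ⋯ ≤ t_k = 1` such that `c` is `C¹` on every closed interval of the partition. -/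
def IsPiecewiseC1 {m : ℕ} (c : ℝ → Fin m → ℝ) : Prop :=
  ∃ (k : ℕ) (t : Fin (k + 1) → ℝ), Monotone t ∧ t 0 = 0 ∧ t (Fin.last k) = 1 ∧
    ∀ i : Fin k, ContDiffOn ℝ 1 c (Set.Icc (t i.castSucc) (t i.succ))

/-- The partial derivative `∂_i f (θ)` of a matrix-valued function of `θ ∈ ℝᵐ`. -/
def partialDeriv {n m : ℕ} (i : Fin m) (f : (Fin m → ℝ) → Matrix (Fin n) (Fin n) ℂ)
    (θ : Fin m → ℝ) : Matrix (Fin n) (Fin n) ℂ :=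
  fderiv ℝ f θ (Pi.single i 1)

/-- An `m`-parameter statistical model of strictly positive `n × n` density matrices, twice
continuously differentiable on an open parameter set `Θ ⊆ ℝᵐ`. -/
structure Model (n m : ℕ) where
  Θ : Set (Fin m → ℝ)
  isOpen_Θ : IsOpen Θ
  ρ : (Fin m → ℝ) → Matrix (Fin n) (Fin n) ℂ
  contDiffOn_ρ : ContDiffOn ℝ 2 ρ Θ
  posDef_ρ : ∀ θ ∈ Θ, (ρ θ).PosDef
  trace_ρ : ∀ θ ∈ Θ, (ρ θ).trace = 1

namespace Model

variable {n m : ℕ} (M : Model n m)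

/-- The SLD `L^S_i(θ)` of the parameter `θ^i`. -/
def L (i : Fin m) (θ : Fin m → ℝ) : Matrix (Fin n) (Fin n) ℂ :=
  sld (M.ρ θ) (partialDeriv i M.ρ θ)

/-- The model is locally quasi-classical at `θ`: the SLDs at `θ` commute. -/
def LocallyQuasiClassicalAt (θ : Fin m → ℝ) : Prop :=
  ∀ i j : Fin m, Commute (M.L i θ) (M.L j θ)

/-- `F_ij = (∂_i L_j - ∂_j L_i) - (1/2) [L_i, L_j]`, which represents the curvature form. -/
def F (i j : Fin m) (θ : Fin m → ℝ) : Matrix (Fin n) (Fin n) ℂ :=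
  (partialDeriv i (M.L j) θ - partialDeriv j (M.L i) θ) -
    (1 / 2 : ℂ) • (M.L i θ * M.L j θ - M.L j θ * M.L i θ)

/-- A path in the parameter set, as a curve `[0, 1] → ℝᵐ` (extended constantly to `ℝ`). -/
def curve {x y : M.Θ} (γ : Path x y) : ℝ → Fin m → ℝ :=
  fun t => (γ.extend t : Fin m → ℝ)

/-- The curve of states `t ↦ ρ(γ(t))` over a path in the parameter set. -/
def stateCurve {x y : M.Θ} (γ : Path x y) : ℝ → Matrix (Fin n) (Fin n) ℂ :=
  fun t => M.ρ (M.curve γ t)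

end Model

end QuantumEstimation

end

/-! Put A = ½L. This is the Lyapunov connection form, the solution of Aρ + ρA = dρ, and
horizontality of a lift reads W' = A(γ')W. Horizontal lifts are thus the parallel curves of d − A,
whose curvature R(h,v) = ∂_h A_v − ∂_v A_h − [A_h, A_v] satisfies F_ij = 2 R_ij.

The pointwise equivalence is algebra. Differentiating Aρ + ρA = dρ once more and using the symmetry
of the second derivative gives Rρ + ρR = −2ρ[A_h, A_v] (`IsFaithfulFamily.curvature_anticomm`).
Since ρ is invertible and its anticommutator is injective, R(h,v) vanishes exactly when A_h and A_v
commute.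

Over a loop, W(0) and W(1) lie over the same state, so W(0) is itself the point in phase with W(0),
and the relative phase factor is I exactly when W(1) = W(0) (`isRelativePhaseFactor_one_iff`). The
remaining claims therefore compare flatness with trivial holonomy. If R = 0, transport along rays
gives local parallel frames (`IsFlatOn.exists_isParallelFrameOn`), and a grid on a null-homotopy
shows that horizontal curves close up (`IsFlatOn.eq_of_homotopic_refl`). Conversely, the holonomy of
a suitable loop of size ε is 1 + (ε²/60) R(h,v) + o(ε²), so trivial holonomy on small loops forces R
= 0 (`curvature_eq_zero_of_smallLoop`). These loops contract inside a ball, so testing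
null-homotopic loops is enough. -/

section

open Set Metric Filter Topology

/-- Uniform first order Taylor estimate on a compact convex set. -/
theorem ContDiffOn.exists_uniform_taylor {E F : Type*} [NormedAddCommGroup E] [NormedSpace ℝ E]
    [NormedAddCommGroup F] [NormedSpace ℝ F] {f : E → F} {U K : Set E} (hU : IsOpen U)
    (hf : ContDiffOn ℝ 1 f U) (hK : IsCompact K) (hKc : Convex ℝ K) (hKU : K ⊆ U)
    {ε : ℝ} (hε : 0 < ε) :
    ∃ δ > 0, ∀ y ∈ K, ∀ k, y + k ∈ K → ‖k‖ < δ →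
      ‖f (y + k) - f y - fderiv ℝ f y k‖ ≤ ε * ‖k‖ ∧ ‖f (y + k) - f y‖ ≤ ε := by
  have h1 : ContinuousOn (fderiv ℝ f) K :=
    (hf.continuousOn_fderiv_of_isOpen hU le_rfl).mono hKU
  have h2 := hK.uniformContinuousOn_of_continuous h1
  have h3 := hK.uniformContinuousOn_of_continuous (hf.continuousOn.mono hKU)
  rw [Metric.uniformContinuousOn_iff] at h2 h3
  obtain ⟨δ₁, hδ₁, H₁⟩ := h2 ε hε
  obtain ⟨δ₂, hδ₂, H₂⟩ := h3 ε hε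
  refine ⟨min δ₁ δ₂, lt_min hδ₁ hδ₂, fun y hy k hk hkδ => ⟨?_, ?_⟩⟩
  -- Mean value inequality on a convex set where the derivative stays within ε of its value at `y`.
  · have hc : Convex ℝ (K ∩ ball y δ₁) := hKc.inter (convex_ball y δ₁)
    have := hc.norm_image_sub_le_of_norm_hasFDerivWithin_le' (f := f) (f' := fderiv ℝ f)
      (φ := fderiv ℝ f y) (C := ε) (x := y) (y := y + k) (fun x hx => by
        have := ((hf.differentiableOn (by norm_num)).differentiableAt
          (hU.mem_nhds (hKU hx.1)))
        exact this.hasFDerivAt.hasFDerivWithinAt)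
      (fun x hx => by
        rw [← dist_eq_norm]
        exact (H₁ x hx.1 y hy (by simpa using hx.2)).le)
      ⟨hy, mem_ball_self hδ₁⟩ ⟨hk, by simpa using hkδ.trans_le (min_le_left _ _)⟩
    simpa using this
  · rw [← dist_eq_norm]
    exact (H₂ _ hk _ hy (by simpa using hkδ.trans_le (min_le_right _ _))).le

/-! ### Linear differential equations and parallel frames of flat connections -/

section LinearODE

variable {𝔸 : Type*} [NormedRing 𝔸] [NormedAlgebra ℝ 𝔸]

/-- Grönwall's inequality for approximate solutions of a linear equation on `[0, 1]`. -/
theorem norm_le_of_approx_linearODE {a D D' : ℝ → 𝔸} {η : ℝ} (hη : 0 ≤ η)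
    (hD : ∀ t ∈ Icc (0 : ℝ) 1, HasDerivWithinAt D (D' t) (Icc 0 1) t)
    (ha : ∀ t ∈ Icc (0 : ℝ) 1, ‖a t‖ ≤ 1)
    (hb : ∀ t ∈ Icc (0 : ℝ) 1, ‖D' t - a t * D t‖ ≤ η) :
    ∀ t ∈ Icc (0 : ℝ) 1, ‖D t‖ ≤ 3 * (‖D 0‖ + η) := by
  intro t ht
  have := norm_le_gronwallBound_of_norm_deriv_right_le (f := D) (f' := D') (a := 0) (b := 1)
    (δ := ‖D 0‖) (K := 1) (ε := η) (fun s hs => (hD s hs).continuousWithinAt)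
    (fun s hs => (hD s (Ico_subset_Icc_self hs)).mono_of_mem_nhdsWithin
      (Icc_mem_nhdsGE_of_mem hs)) le_rfl (fun s hs => by
        have hs' := Ico_subset_Icc_self hs
        have e : D' s = a s * D s + (D' s - a s * D s) := by abel
        rw [e]
        refine (norm_add_le _ _).trans (add_le_add ((norm_mul_le _ _).trans ?_) (hb s hs'))
        exact mul_le_mul_of_nonneg_right (ha s hs') (norm_nonneg _)) t ht
  refine this.trans ?_
  rw [gronwallBound_of_K_ne_0 one_ne_zero]
  -- The factor 3 in the conclusion is a bound for e.
  have he : Real.exp (1 * (t - 0)) ≤ 3 := by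
    have : Real.exp (1 * (t - 0)) ≤ Real.exp 1 := Real.exp_le_exp.2 (by linarith [ht.2])
    linarith [Real.exp_one_lt_d9]
  have h0 := norm_nonneg (D 0)
  nlinarith [mul_le_mul_of_nonneg_left he h0, mul_le_mul_of_nonneg_left he hη]

/-- On the unit ball around 1 one has ‖x‖ ≤ ‖1‖ + 1, so the smallness of `a` bounds the vector field
by 1 and Picard–Lindelöf reaches time 1 without leaving the ball. The norm of 1 is kept explicit
because it need not be 1. -/
theorem exists_linearODE_solution [CompleteSpace 𝔸] {a : ℝ → 𝔸} (hac : ContinuousOn a (Icc 0 1))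
    (ha : ∀ t ∈ Icc (0 : ℝ) 1, ‖a t‖ * (‖(1 : 𝔸)‖ + 1) ≤ 1) :
    ∃ g : ℝ → 𝔸, g 0 = 1 ∧
      ∀ t ∈ Icc (0 : ℝ) 1, HasDerivWithinAt g (a t * g t) (Icc 0 1) t := by
  have ha1 : ∀ t ∈ Icc (0 : ℝ) 1, ‖a t‖ ≤ 1 := fun t ht => by
    nlinarith [ha t ht, norm_nonneg (a t), norm_nonneg (1 : 𝔸)]
  have : IsPicardLindelof (fun t x => a t * x) (⟨0, by simp⟩ : Icc (0 : ℝ) 1) (1 : 𝔸) 1 0 1 1 := by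
    refine ⟨fun t ht => ?_, fun x _ => hac.mul continuousOn_const, fun t ht x hx => ?_, ?_⟩
    · refine LipschitzOnWith.of_dist_le_mul fun x _ y _ => ?_
      rw [dist_eq_norm, dist_eq_norm, ← mul_sub]
      exact (norm_mul_le _ _).trans (mul_le_mul_of_nonneg_right (ha1 t ht) (norm_nonneg _))
    · have hx' : ‖x‖ ≤ ‖(1 : 𝔸)‖ + 1 := by
        have h1 : ‖x - 1‖ ≤ 1 := by simpa [dist_eq_norm] using hx
        have := norm_add_le (1 : 𝔸) (x - 1)
        rw [add_sub_cancel] at this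
        linarith
      refine (norm_mul_le _ _).trans ?_
      exact (mul_le_mul_of_nonneg_left hx' (norm_nonneg _)).trans (ha t ht)
    · simp
  exact this.exists_eq_forall_mem_Icc_hasDerivWithinAt₀

/-- The connection form `A` (with covariant derivative `d - A`) is flat on `U`. -/
def IsFlatOn {E : Type*} [NormedAddCommGroup E] [NormedSpace ℝ E] (A : E → E →L[ℝ] 𝔸)
    (U : Set E) : Prop :=
  ∀ x ∈ U, ∀ h v, fderiv ℝ A x h v - fderiv ℝ A x v h = A x h * A x v - A x v * A x h

/-- `G` is a parallel frame of the connection form `A` on `V`. -/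
def IsParallelFrameOn {E : Type*} [NormedAddCommGroup E] [NormedSpace ℝ E] (A : E → E →L[ℝ] 𝔸)
    (G : E → 𝔸) (V : Set E) : Prop :=
  ∀ x ∈ V, IsUnit (G x) ∧
    HasFDerivAt G (((ContinuousLinearMap.mul ℝ 𝔸).flip (G x)).comp (A x)) x

/-- Transports `g x` along the segments from `c` to `x` of a flat connection have the derivative
prescribed by the connection. -/
theorem IsFlatOn.hasFDerivAt_radial {E : Type*} [NormedAddCommGroup E]
    [NormedSpace ℝ E] [ProperSpace E] {A : E → E →L[ℝ] 𝔸} {U : Set E} (hU : IsOpen U)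
    (hA : ContDiffOn ℝ 1 A U) (hflat : IsFlatOn A U) {c : E} {r M : ℝ}
    (hrU : closedBall c r ⊆ U) (hM : ∀ x ∈ closedBall c r, ‖A x‖ ≤ M) (hMr : M * r ≤ 1)
    {g : E → ℝ → 𝔸} (hg0 : ∀ x ∈ ball c r, g x 0 = 1)
    (hg : ∀ x ∈ ball c r, ∀ t ∈ Icc (0 : ℝ) 1,
      HasDerivWithinAt (g x) (A (c + t • (x - c)) (x - c) * g x t) (Icc 0 1) t)
    {x : E} (hx : x ∈ ball c r) :
    HasFDerivAt (fun y => g y 1)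
      (((ContinuousLinearMap.mul ℝ 𝔸).flip (g x 1)).comp (A x)) x := by
  have hr : 0 < r := pos_of_mem_ball hx
  have hM0 : 0 ≤ M := (norm_nonneg _).trans (hM c (mem_closedBall_self hr.le))
  have hseg : ∀ y ∈ ball c r, ∀ t ∈ Icc (0 : ℝ) 1, c + t • (y - c) ∈ closedBall c r := by
    intro y hy t ht
    exact (convex_closedBall c r).add_smul_sub_mem (mem_closedBall_self hr.le)
      (ball_subset_closedBall hy) ht
  have hdist : ∀ y ∈ ball c r, ‖y - c‖ ≤ r := fun y hy => (mem_ball_iff_norm.1 hy).le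
  have hcoef : ∀ y ∈ ball c r, ∀ t ∈ Icc (0 : ℝ) 1, ‖A (c + t • (y - c)) (y - c)‖ ≤ 1 := by
    intro y hy t ht
    refine ((A _).le_opNorm _).trans (le_trans ?_ hMr)
    exact mul_le_mul (hM _ (hseg y hy t ht)) (hdist y hy) (norm_nonneg _) hM0
  have hgb : ∀ y ∈ ball c r, ∀ t ∈ Icc (0 : ℝ) 1, ‖g y t‖ ≤ 3 * ‖(1 : 𝔸)‖ := by
    intro y hy t ht
    have := norm_le_of_approx_linearODE le_rfl (hg y hy) (hcoef y hy) (by simp) t ht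
    simpa [hg0 y hy] using this
  rw [hasFDerivAt_iff_isLittleO_nhds_zero, Asymptotics.isLittleO_iff]
  intro e he
  set B := 3 * ‖(1 : 𝔸)‖ with hB
  have hB0 : 0 ≤ B := by positivity
  -- The three summands match the bounds `n1`, `n2`, `n5` below; `B` bounds the transport. The later
  -- choice ε = e / (3C + 1) absorbs the Grönwall factor 3.
  set C := (r + 1 + (r + M) * M) * B with hC
  have hC0 : 0 ≤ C := by positivity
  obtain ⟨δ, hδ, H⟩ := hA.exists_uniform_taylor hU (isCompact_closedBall c r)
    (convex_closedBall c r) hrU (ε := e / (3 * C + 1)) (by positivity)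
  set ε := e / (3 * C + 1) with hε
  have hε0 : 0 < ε := by positivity
  have hev1 : ∀ᶠ h in 𝓝 (0 : E), x + h ∈ ball c r := by
    have : ContinuousAt (fun h : E => x + h) 0 := by fun_prop
    exact this.preimage_mem_nhds (by simpa using isOpen_ball.mem_nhds hx)
  have hev2 : ∀ᶠ h in 𝓝 (0 : E), ‖h‖ < min δ ε := by
    have : ball (0 : E) (min δ ε) ∈ 𝓝 0 := ball_mem_nhds _ (lt_min hδ hε0)
    filter_upwards [this] with h hh using by simpa using hh
  filter_upwards [hev1, hev2] with h hxh hh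
  have hhδ := hh.trans_le (min_le_left _ _)
  have hhε := (hh.trans_le (min_le_right _ _)).le
  set v := x - c with hv
  have hvr : ‖v‖ ≤ r := hdist x hx
  let y : ℝ → E := fun t => c + t • v
  have hyt : ∀ t ∈ Icc (0 : ℝ) 1, y t ∈ closedBall c r := hseg x hx
  have hyh : ∀ t : ℝ, c + t • (x + h - c) = y t + t • h := by
    intro t; simp only [y, hv, smul_sub, smul_add]; abel
  have hvh : x + h - c = v + h := by rw [hv]; abel
  have hAd : ∀ t ∈ Icc (0 : ℝ) 1, HasDerivWithinAt (fun t => A (y t) h)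
      (fderiv ℝ A (y t) v h) (Icc 0 1) t := by
    intro t ht
    have h1 : HasFDerivAt A (fderiv ℝ A (y t)) (y t) :=
      ((hA.differentiableOn (by norm_num)).differentiableAt
        (hU.mem_nhds (hrU (hyt t ht)))).hasFDerivAt
    have h2 : HasDerivAt y v t := by
      have := ((hasDerivAt_id t).smul_const v).const_add c
      rwa [one_smul] at this
    have h3 := h1.comp_hasDerivAt t h2
    exact ((ContinuousLinearMap.apply ℝ 𝔸 h).hasFDerivAt.comp_hasDerivAt t h3).hasDerivWithinAt
  -- Moving the endpoint by `h` moves the ray by `t • h` at time `t`. `D` compares the transport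
  -- along the moved ray with its predicted first order value; at `t = 1` it is the remainder of the
  -- derivative.
  let D : ℝ → 𝔸 := fun t => g (x + h) t - (1 + t • A (y t) h) * g x t
  let D' : ℝ → 𝔸 := fun t => A (y t + t • h) (v + h) * g (x + h) t -
    ((A (y t) h + t • fderiv ℝ A (y t) v h) * g x t +
      (1 + t • A (y t) h) * (A (y t) v * g x t))
  have hD : ∀ t ∈ Icc (0 : ℝ) 1, HasDerivWithinAt D (D' t) (Icc 0 1) t := by
    intro t ht
    have h1 := hg (x + h) hxh t ht
    rw [hyh, hvh] at h1
    have h2 := hg x hx t ht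
    have h3 := (((hasDerivWithinAt_id t (Icc 0 1)).smul (hAd t ht)).const_add (1 : 𝔸)).mul h2
    refine (h1.sub h3).congr_deriv ?_
    simp only [D', id, one_smul]
    congr 3
    abel
  have hcoef' : ∀ t ∈ Icc (0 : ℝ) 1, ‖A (y t + t • h) (v + h)‖ ≤ 1 := by
    intro t ht
    have := hcoef (x + h) hxh t ht
    rwa [hyh, hvh] at this
  have hbound : ∀ t ∈ Icc (0 : ℝ) 1,
      ‖D' t - A (y t + t • h) (v + h) * D t‖ ≤ ε * C * ‖h‖ := by
    intro t ht
    have hfl := hflat (y t) (hrU (hyt t ht)) h v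
    have hmem : y t + t • h ∈ closedBall c r := by rw [← hyh]; exact hseg _ hxh t ht
    have hth : ‖t • h‖ ≤ ‖h‖ := by
      rw [norm_smul, Real.norm_of_nonneg ht.1]
      exact mul_le_of_le_one_left (norm_nonneg _) ht.2
    obtain ⟨T1, T2⟩ := H (y t) (hyt t ht) (t • h) hmem (hth.trans_lt hhδ)
    -- Flatness exchanges the two slots of the derivative of `A` at the cost of a commutator, which
    -- cancels every first order term. Only a Taylor remainder and products of two small quantities
    -- are left.
    have key : D' t - A (y t + t • h) (v + h) * D t =
        ((A (y t + t • h) - A (y t) - fderiv ℝ A (y t) (t • h)) v +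
          (A (y t + t • h) - A (y t)) h +
          t • (((A (y t + t • h) - A (y t)) v + A (y t + t • h) h) * A (y t) h)) * g x t := by
      have e1 : fderiv ℝ A (y t) v h = fderiv ℝ A (y t) h v -
          (A (y t) h * A (y t) v - A (y t) v * A (y t) h) := by rw [← hfl]; abel
      simp only [D', D, e1, map_add, map_smul, sub_apply, smul_apply, add_mul, mul_add, sub_mul, mul_sub, smul_add, smul_sub,
        smul_mul_assoc, mul_smul_comm, one_mul, mul_assoc]
      abel
    rw [key]
    have n1 : ‖(A (y t + t • h) - A (y t) - fderiv ℝ A (y t) (t • h)) v‖ ≤ ε * ‖h‖ * r := by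
      refine (ContinuousLinearMap.le_opNorm _ _).trans ?_
      refine mul_le_mul (T1.trans ?_) hvr (norm_nonneg _) (by positivity)
      exact mul_le_mul_of_nonneg_left hth hε0.le
    have n2 : ‖(A (y t + t • h) - A (y t)) h‖ ≤ ε * ‖h‖ := by
      refine (ContinuousLinearMap.le_opNorm _ _).trans ?_
      exact mul_le_mul_of_nonneg_right T2 (norm_nonneg _)
    have n3 : ‖(A (y t + t • h) - A (y t)) v + A (y t + t • h) h‖ ≤ ε * r + M * ε := by
      refine (norm_add_le _ _).trans (add_le_add ?_ ?_)
      · exact (ContinuousLinearMap.le_opNorm _ _).trans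
          (mul_le_mul T2 hvr (norm_nonneg _) hε0.le)
      · exact (ContinuousLinearMap.le_opNorm _ _).trans
          (mul_le_mul (hM _ hmem) hhε (norm_nonneg _) hM0)
    have n4 : ‖A (y t) h‖ ≤ M * ‖h‖ := (ContinuousLinearMap.le_opNorm _ _).trans
      (mul_le_mul_of_nonneg_right (hM _ (hyt t ht)) (norm_nonneg _))
    have n5 : ‖t • (((A (y t + t • h) - A (y t)) v + A (y t + t • h) h) * A (y t) h)‖ ≤
        (ε * r + M * ε) * (M * ‖h‖) := by
      rw [norm_smul, Real.norm_of_nonneg ht.1]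
      refine (mul_le_of_le_one_left (norm_nonneg _) ht.2).trans ((norm_mul_le _ _).trans ?_)
      exact mul_le_mul n3 n4 (norm_nonneg _) (by positivity)
    refine (norm_mul_le _ _).trans ?_
    refine (mul_le_mul ((norm_add₃_le).trans (add_le_add_three n1 n2 n5)) (hgb x hx t ht)
      (norm_nonneg _) (by positivity)).trans (le_of_eq ?_)
    rw [hC]; ring
  have hD1 := norm_le_of_approx_linearODE (by positivity) hD hcoef' hbound 1 (by simp)
  have hD0 : D 0 = 0 := by simp [D, hg0 x hx, hg0 _ hxh]
  have hfin : g (x + h) 1 - g x 1 -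
      (((ContinuousLinearMap.mul ℝ 𝔸).flip (g x 1)).comp (A x)) h = D 1 := by
    simp [D, y, hv, add_mul]
    abel
  rw [hfin]
  refine hD1.trans ?_
  rw [hD0, norm_zero, zero_add]
  have : 3 * (ε * C * ‖h‖) = e * ((3 * C) / (3 * C + 1)) * ‖h‖ := by rw [hε]; field_simp
  rw [this]
  refine mul_le_mul_of_nonneg_right (mul_le_of_le_one_right he.le ?_) (norm_nonneg _)
  rw [div_le_one (by positivity)]; linarith

/-- The frame is the transport of 1 along the segment from `c`. The radius is small enough for the
equation to be solvable up to time 1, and is then shrunk so that the frame is invertible. -/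
theorem IsFlatOn.exists_isParallelFrameOn [CompleteSpace 𝔸] {E : Type*} [NormedAddCommGroup E]
    [NormedSpace ℝ E] [ProperSpace E] {A : E → E →L[ℝ] 𝔸} {U : Set E} (hU : IsOpen U)
    (hA : ContDiffOn ℝ 1 A U) (hflat : IsFlatOn A U) {c : E} (hc : c ∈ U) :
    ∃ r > 0, ∃ G : E → 𝔸, IsParallelFrameOn A G (ball c r) := by
  obtain ⟨r₀, hr₀, hr₀U⟩ := Metric.nhds_basis_closedBall.mem_iff.1 (hU.mem_nhds hc)
  obtain ⟨M, hM⟩ := (isCompact_closedBall c r₀).exists_bound_of_continuousOn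
    (hA.continuousOn.mono hr₀U)
  have hM0 : 0 ≤ M := (norm_nonneg _).trans (hM c (mem_closedBall_self hr₀.le))
  have hN : 0 < ‖(1 : 𝔸)‖ + 1 := by positivity
  obtain ⟨r, hr, hrr₀, hMr⟩ : ∃ r > 0, r ≤ r₀ ∧ M * r * (‖(1 : 𝔸)‖ + 1) ≤ 1 := by
    refine ⟨min r₀ (1 / ((M + 1) * (‖(1 : 𝔸)‖ + 1))), lt_min hr₀ (by positivity),
      min_le_left _ _, ?_⟩
    have h1 := min_le_right r₀ (1 / ((M + 1) * (‖(1 : 𝔸)‖ + 1)))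
    calc _ ≤ M * (1 / ((M + 1) * (‖(1 : 𝔸)‖ + 1))) * (‖(1 : 𝔸)‖ + 1) := by gcongr
      _ = M / (M + 1) := by field_simp
      _ ≤ 1 := by rw [div_le_one (by positivity)]; linarith
  have hsub : closedBall c r ⊆ closedBall c r₀ := closedBall_subset_closedBall hrr₀
  have hMr1 : M * r ≤ 1 := by
    nlinarith [norm_nonneg (1 : 𝔸), mul_nonneg hM0 hr.le]
  have hex : ∀ x ∈ ball c r, ∃ g : ℝ → 𝔸, g 0 = 1 ∧ ∀ t ∈ Icc (0 : ℝ) 1,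
      HasDerivWithinAt g (A (c + t • (x - c)) (x - c) * g t) (Icc 0 1) t := by
    intro x hx
    have hseg : ∀ t ∈ Icc (0 : ℝ) 1, c + t • (x - c) ∈ closedBall c r := fun t ht =>
      (convex_closedBall c r).add_smul_sub_mem (mem_closedBall_self hr.le)
        (ball_subset_closedBall hx) ht
    refine exists_linearODE_solution (a := fun t => A (c + t • (x - c)) (x - c)) ?_ ?_
    · refine ContinuousOn.clm_apply ?_ continuousOn_const
      refine hA.continuousOn.comp (by fun_prop) fun t ht => hr₀U (hsub (hseg t ht))
    · intro t ht
      refine le_trans ?_ hMr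
      refine mul_le_mul_of_nonneg_right ?_ hN.le
      refine ((A _).le_opNorm _).trans ?_
      exact mul_le_mul (hM _ (hsub (hseg t ht))) (mem_ball_iff_norm.1 hx).le (norm_nonneg _) hM0
  choose! g hg0 hg using hex
  have hder : ∀ x ∈ ball c r, HasFDerivAt (fun y => g y 1)
      (((ContinuousLinearMap.mul ℝ 𝔸).flip (g x 1)).comp (A x)) x := fun x hx =>
    hflat.hasFDerivAt_radial hU hA (hsub.trans hr₀U) (fun x hx => hM x (hsub hx)) hMr1 hg0 hg hx
  have hcb : c ∈ ball c r := mem_ball_self hr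
  -- The segment from `c` to itself has zero velocity, so transport along it is constant.
  have hc1 : g c 1 = 1 := by
    have := norm_le_of_approx_linearODE (a := 0) (D := fun t => g c t - 1)
      (D' := fun t => A (c + t • (c - c)) (c - c) * g c t) le_rfl
      (fun t ht => (hg c hcb t ht).sub_const 1) (by simp) (by simp) 1 (by simp)
    simpa [hg0 c hcb, sub_eq_zero] using this
  have hunit : ∀ᶠ x in 𝓝 c, IsUnit (g x 1) := by
    have h1 : ContinuousAt (fun y => g y 1) c := (hder c hcb).continuousAt
    exact h1.preimage_mem_nhds (Units.isOpen.mem_nhds (by rw [hc1]; exact isUnit_one))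
  obtain ⟨r₁, hr₁, H⟩ := Metric.eventually_nhds_iff_ball.1 hunit
  refine ⟨min r r₁, lt_min hr hr₁, fun y => g y 1, fun x hx => ⟨H x ?_, hder x ?_⟩⟩
  · exact ball_subset_ball (min_le_right _ _) hx
  · exact ball_subset_ball (min_le_left _ _) hx

end LinearODE

/-! ### Parallel transport and homotopy invariance -/

section Transport

variable {𝔸 : Type*} [NormedRing 𝔸] [NormedAlgebra ℝ 𝔸] [CompleteSpace 𝔸]
  {E : Type*} [NormedAddCommGroup E] [NormedSpace ℝ E]

/-- A horizontal curve is carried by any parallel frame, up to a constant factor. -/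
theorem IsParallelFrameOn.transport {A : E → E →L[ℝ] 𝔸} {G : E → 𝔸} {V : Set E}
    (hG : IsParallelFrameOn A G V) {γ : ℝ → E} {W : ℝ → 𝔸} {a b : ℝ} (hab : a ≤ b)
    (hγ : ContinuousOn γ (Icc a b)) (hmem : ∀ t ∈ Icc a b, γ t ∈ V)
    (hW : ContinuousOn W (Icc a b)) (S : Finset ℝ)
    (hder : ∀ t ∈ Ioo a b, t ∉ S →
      ∃ w, HasDerivAt γ w t ∧ HasDerivAt W (A (γ t) w * W t) t) :
    W b = G (γ b) * (Ring.inverse (G (γ a)) * W a) := by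
  have hinv : ∀ t ∈ Icc a b, HasFDerivAt Ring.inverse
      (-(ContinuousLinearMap.mulLeftRight ℝ 𝔸 (Ring.inverse (G (γ t)))
        (Ring.inverse (G (γ t))))) (G (γ t)) := by
    intro t ht
    obtain ⟨u, hu⟩ := (hG _ (hmem t ht)).1
    rw [← hu, Ring.inverse_unit]
    exact hasFDerivAt_ringInverse u
  have hcont : ContinuousOn (fun t => Ring.inverse (G (γ t)) * W t) (Icc a b) := by
    refine ContinuousOn.mul (fun t ht => ?_) hW
    have h1 : ContinuousWithinAt (fun t => G (γ t)) (Icc a b) t :=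
      (hG _ (hmem t ht)).2.continuousAt.comp_continuousWithinAt (hγ t ht)
    exact ContinuousAt.comp_continuousWithinAt (f := fun t => G (γ t))
      (hinv t ht).continuousAt h1
  -- G⁻¹W is continuous with zero derivative off the finite set `S`, so the fundamental theorem of
  -- calculus with countably many exceptions equates its endpoint values.
  have hconst := MeasureTheory.integral_eq_of_hasDerivAt_off_countable_of_le
    (fun t => Ring.inverse (G (γ t)) * W t) (fun _ => 0) hab S.countable_toSet hcont
    (fun t ht => by
      obtain ⟨w, hw, hWt⟩ := hder t ht.1 ht.2
      have ht' := Ioo_subset_Icc_self ht.1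
      have h1 := (hG _ (hmem t ht')).2.comp_hasDerivAt t hw
      have h2 := ((hinv t ht').comp_hasDerivAt t h1).mul hWt
      refine h2.congr_deriv ?_
      have hu' := Ring.mul_inverse_cancel _ (hG _ (hmem t ht')).1
      simp only [neg_apply, ContinuousLinearMap.mulLeftRight_apply,
        ContinuousLinearMap.comp_apply, ContinuousLinearMap.flip_apply,
        ContinuousLinearMap.mul_apply', Function.comp_apply, mul_assoc]
      rw [hu', mul_one, neg_mul, mul_assoc, neg_add_cancel]) (by simp)
  rw [intervalIntegral.integral_zero, eq_comm, sub_eq_zero] at hconst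
  have hb := Ring.mul_inverse_cancel _ (hG _ (hmem b (right_mem_Icc.2 hab))).1
  rw [← hconst, ← mul_assoc, hb, one_mul]

/-- Horizontal curves of a flat connection over a null-homotopic loop are closed. -/
theorem IsFlatOn.eq_of_homotopic_refl [ProperSpace E] {A : E → E →L[ℝ] 𝔸} {U : Set E}
    (hU : IsOpen U) (hA : ContDiffOn ℝ 1 A U) (hflat : IsFlatOn A U) {x : U} {γ : Path x x}
    (hγ : γ.Homotopic (Path.refl x)) {W : ℝ → 𝔸} (hW : ContinuousOn W (Icc 0 1)) (S : Finset ℝ)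
    (hder : ∀ t ∈ Ioo (0 : ℝ) 1, t ∉ S → ∃ w, HasDerivAt (fun t => (γ.extend t : E)) w t ∧
      HasDerivAt W (A (γ.extend t) w * W t) t) :
    W 1 = W 0 := by
  classical
  have hfr : ∀ c : U, ∃ r > 0, ∃ G : E → 𝔸, IsParallelFrameOn A G (ball (c : E) r) := fun c =>
    hflat.exists_isParallelFrameOn hU hA c.2
  choose r hr G hG using hfr
  -- `P y z` is the local transport from `y` to `z`. It does not depend on the ball: the segment
  -- from `y` to `z` lies in each convex ball containing both points, and the two frames agree on
  -- transport along it.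
  obtain ⟨P, hP⟩ : ∃ P : E → E → 𝔸, ∀ c : U, ∀ y ∈ ball (c : E) (r c), ∀ z ∈ ball (c : E) (r c),
      P y z = G c z * Ring.inverse (G c y) := by
    refine ⟨fun y z => if h : ∃ c : U, y ∈ ball (c : E) (r c) ∧ z ∈ ball (c : E) (r c) then
      G h.choose z * Ring.inverse (G h.choose y) else 1, fun c y hy z hz => ?_⟩
    have h : ∃ c : U, y ∈ ball (c : E) (r c) ∧ z ∈ ball (c : E) (r c) := ⟨c, hy, hz⟩
    simp only [dif_pos h]
    generalize hc' : h.choose = c'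
    obtain ⟨hy', hz'⟩ := h.choose_spec
    rw [hc'] at hy' hz'
    let l : ℝ → E := fun t => y + t • (z - y)
    have hl : ∀ (c : U), y ∈ ball (c : E) (r c) → z ∈ ball (c : E) (r c) →
        ∀ t ∈ Icc (0 : ℝ) 1, l t ∈ ball (c : E) (r c) := fun c hy hz t ht =>
      (convex_ball (c : E) (r c)).add_smul_sub_mem hy hz ht
    have hld : ∀ t, HasDerivAt l (z - y) t := fun t => by
      have := ((hasDerivAt_id t).smul_const (z - y)).const_add y
      rwa [one_smul] at this
    have hGd : ∀ t ∈ Icc (0 : ℝ) 1, HasDerivAt (fun t => G c' (l t) * Ring.inverse (G c' y))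
        (A (l t) (z - y) * (G c' (l t) * Ring.inverse (G c' y))) t := fun t ht => by
      have := ((hG c' _ (hl c' hy' hz' t ht)).2.comp_hasDerivAt t (hld t)).mul_const
        (Ring.inverse (G c' y))
      refine this.congr_deriv ?_
      simp only [ContinuousLinearMap.comp_apply, ContinuousLinearMap.flip_apply,
        ContinuousLinearMap.mul_apply', mul_assoc]
    have := (hG c).transport (γ := l) (W := fun t => G c' (l t) * Ring.inverse (G c' y))
      zero_le_one (fun t _ => (hld t).continuousAt.continuousWithinAt) (hl c hy hz)
      (fun t ht => (hGd t ht).continuousAt.continuousWithinAt) ∅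
      (fun t ht _ => ⟨_, hld t, hGd t (Ioo_subset_Icc_self ht)⟩)
    simpa [l, Ring.mul_inverse_cancel _ (hG c' y hy').1] using this
  have hPmul : ∀ c : U, ∀ y ∈ ball (c : E) (r c), ∀ z ∈ ball (c : E) (r c),
      ∀ w ∈ ball (c : E) (r c), P z w * P y z = P y w := by
    intro c y hy z hz w hw
    rw [hP c z hz w hw, hP c y hy z hz, hP c y hy w hw, mul_assoc,
      ← mul_assoc _ (G c z), Ring.inverse_mul_cancel _ (hG c z hz).1, one_mul]
  have hPself : ∀ y : U, P y y = 1 := fun y => by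
    rw [hP y y (mem_ball_self (hr y)) y (mem_ball_self (hr y)),
      Ring.mul_inverse_cancel _ (hG y y (mem_ball_self (hr y))).1]
  obtain ⟨H⟩ := hγ
  have hHc : Continuous fun p : unitInterval × unitInterval => (H p : E) :=
    continuous_subtype_val.comp H.continuous
  -- A grid on the square such that the homotopy maps each cell into one ball carrying a frame. The
  -- first coordinate is the homotopy parameter, the second the time along the path.
  obtain ⟨t, ht0, htm, ⟨N, hN⟩, ht⟩ := exists_monotone_Icc_subset_open_cover_unitInterval_prod_self
    (c := fun c : U => {p | (H p : E) ∈ ball (c : E) (r c)})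
    (fun c => isOpen_ball.preimage hHc)
    (fun p _ => mem_iUnion.2 ⟨H p, mem_ball_self (hr _)⟩)
  let h : ℕ → ℕ → E := fun j k => H (t j, t k)
  -- Discrete transport along row `j` up to column `k`.
  let Q : ℕ → ℕ → 𝔸 := fun j k => Nat.rec 1 (fun k q => P (h j k) (h j (k + 1)) * q) k
  have hQ : ∀ j k, Q j (k + 1) = P (h j k) (h j (k + 1)) * Q j k := fun j k => rfl
  have hh0 : ∀ j, h j 0 = x := fun j => by simp [h, ht0]
  have hhN : ∀ j, h j N = x := fun j => by simp [h, hN N le_rfl]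
  -- Both ways around a cell give the same transport, so adjacent rows differ by the vertical edge.
  -- At columns 0 and `N` that edge is constant, as the homotopy fixes endpoints.
  have hladder : ∀ j k, P (h j k) (h (j + 1) k) * Q j k = Q (j + 1) k := by
    intro j k
    induction k with
    | zero => simp [hh0, hPself, Q]
    | succ k ih =>
      obtain ⟨c, hc⟩ := ht j k
      have hj := htm (Nat.le_succ j)
      have hk := htm (Nat.le_succ k)
      have m1 : h j k ∈ ball (c : E) (r c) := hc ⟨left_mem_Icc.2 hj, left_mem_Icc.2 hk⟩
      have m2 : h j (k + 1) ∈ ball (c : E) (r c) := hc ⟨left_mem_Icc.2 hj, right_mem_Icc.2 hk⟩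
      have m3 : h (j + 1) k ∈ ball (c : E) (r c) := hc ⟨right_mem_Icc.2 hj, left_mem_Icc.2 hk⟩
      have m4 : h (j + 1) (k + 1) ∈ ball (c : E) (r c) :=
        hc ⟨right_mem_Icc.2 hj, right_mem_Icc.2 hk⟩
      rw [hQ, hQ, ← ih, ← mul_assoc, ← mul_assoc, hPmul c _ m1 _ m2 _ m4,
        hPmul c _ m1 _ m3 _ m4]
  have hQN : ∀ j, Q j N = Q 0 N := by
    intro j
    induction j with
    | zero => rfl
    | succ j ih => rw [← hladder, hhN, hhN, hPself, one_mul, ih]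
  have hQ1 : ∀ k, Q N k = 1 := by
    intro k
    induction k with
    | zero => rfl
    | succ k ih =>
      have : ∀ k, h N k = x := fun k => by simp [h, hN N le_rfl]
      rw [hQ, ih, this, this, hPself, one_mul]
  have hWQ : ∀ k, W (t k) = Q 0 k * W 0 := by
    intro k
    induction k with
    | zero => simp [ht0, Q]
    | succ k ih =>
      obtain ⟨c, hc⟩ := ht 0 k
      have hk : (t k : ℝ) ≤ t (k + 1) := htm (Nat.le_succ k)
      have hI : Icc (t k : ℝ) (t (k + 1)) ⊆ Icc 0 1 := Icc_subset_Icc (t k).2.1 (t (k + 1)).2.2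
      have hmem : ∀ s ∈ Icc (t k : ℝ) (t (k + 1)),
          (γ.extend s : E) ∈ ball (c : E) (r c) := by
        intro s hs
        have := @hc (t 0, ⟨s, hI hs⟩) ⟨left_mem_Icc.2 (htm (Nat.le_succ 0)), hs⟩
        rw [mem_ofPred_eq, ht0, H.apply_zero] at this
        rw [Path.extend_apply _ (hI hs)]
        exact this
      have hext : ∀ k, (γ.extend (t k) : E) = h 0 k := fun k => by
        simp [h, ht0]
      have hcont : Continuous fun s : ℝ => (γ.extend s : E) :=
        continuous_subtype_val.comp γ.continuous_extend
      have := (hG c).transport hk hcont.continuousOn hmem (hW.mono hI) S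
        (fun s hs hsS => hder s ⟨(t k).2.1.trans_lt hs.1, hs.2.trans_le (t (k + 1)).2.2⟩ hsS)
      have m1 := hmem _ (left_mem_Icc.2 hk)
      have m2 := hmem _ (right_mem_Icc.2 hk)
      rw [this, hQ, ih, ← hext, ← hext, hP c _ m1 _ m2, mul_assoc, mul_assoc]
  have := hWQ N
  rwa [hN N le_rfl, ← hQN N, hQ1, one_mul] at this

end Transport

/-! ### Curvature as the second order term of holonomy -/

section SmallLoop

variable {E : Type*} [NormedAddCommGroup E] [NormedSpace ℝ E]

theorem hasDerivAt_id_sub_sq (t : ℝ) : HasDerivAt (fun t : ℝ => t - t ^ 2) (1 - 2 * t) t :=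
  ((hasDerivAt_id t).sub (hasDerivAt_pow 2 t)).congr_deriv (by norm_num)

theorem hasDerivAt_sq_sub_cube (t : ℝ) :
    HasDerivAt (fun t : ℝ => t ^ 2 - t ^ 3) (2 * t - 3 * t ^ 2) t :=
  ((hasDerivAt_pow 2 t).sub (hasDerivAt_pow 3 t)).congr_deriv (by norm_num)

theorem hasDerivAt_quintic (t : ℝ) :
    HasDerivAt (fun t : ℝ => 2 / 3 * t ^ 3 - 5 / 4 * t ^ 4 + 3 / 5 * t ^ 5)
      ((t - t ^ 2) * (2 * t - 3 * t ^ 2)) t := by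
  refine ((((hasDerivAt_pow 3 t).const_mul (2 / 3 : ℝ)).sub
    ((hasDerivAt_pow 4 t).const_mul (5 / 4 : ℝ))).add
    ((hasDerivAt_pow 5 t).const_mul (3 / 5 : ℝ))).congr_deriv ?_
  norm_num
  ring

/-- The primitive of `B (u t) (u' t)` for a bilinear `B` with values `b₁ = B h h`, `b₂ = B v v`,
`b₃ = B h v`, `b₄ = B v h`, where `u t = (t - t²) h + (t² - t³) v`. -/
noncomputable def loopPrimitive (b₁ b₂ b₃ b₄ : E) (t : ℝ) : E :=
  ((t - t ^ 2) ^ 2 / 2) • b₁ + ((t ^ 2 - t ^ 3) ^ 2 / 2) • b₂ +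
    (2 / 3 * t ^ 3 - 5 / 4 * t ^ 4 + 3 / 5 * t ^ 5) • b₃ +
    ((t - t ^ 2) * (t ^ 2 - t ^ 3) - (2 / 3 * t ^ 3 - 5 / 4 * t ^ 4 + 3 / 5 * t ^ 5)) • b₄

theorem hasDerivAt_loopPrimitive (b₁ b₂ b₃ b₄ : E) (t : ℝ) :
    HasDerivAt (loopPrimitive b₁ b₂ b₃ b₄)
      (((t - t ^ 2) * (1 - 2 * t)) • b₁ + ((t ^ 2 - t ^ 3) * (2 * t - 3 * t ^ 2)) • b₂ +
        ((t - t ^ 2) * (2 * t - 3 * t ^ 2)) • b₃ + ((t ^ 2 - t ^ 3) * (1 - 2 * t)) • b₄) t := by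
  refine (((((((hasDerivAt_id_sub_sq t).pow 2).div_const 2).smul_const b₁).add
    ((((hasDerivAt_sq_sub_cube t).pow 2).div_const 2).smul_const b₂)).add
    ((hasDerivAt_quintic t).smul_const b₃)).add
    ((((hasDerivAt_id_sub_sq t).mul (hasDerivAt_sq_sub_cube t)).sub
      (hasDerivAt_quintic t)).smul_const b₄)).congr_deriv ?_
  norm_num
  module

theorem loopPrimitive_zero (b₁ b₂ b₃ b₄ : E) : loopPrimitive b₁ b₂ b₃ b₄ 0 = 0 := by
  simp [loopPrimitive]

/-- The symmetric terms are exact and integrate to zero around the loop. What survives is the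
enclosed area ∫₀¹ (t − t²)(2t − 3t²) dt = 2/3 − 5/4 + 3/5 = 1/60; only its being nonzero matters. -/
theorem loopPrimitive_one (b₁ b₂ b₃ b₄ : E) :
    loopPrimitive b₁ b₂ b₃ b₄ 1 = (1 / 60 : ℝ) • (b₃ - b₄) := by
  unfold loopPrimitive
  norm_num
  module

theorem norm_loopPrimitive_le (b₁ b₂ b₃ b₄ : E) {t : ℝ} (ht : t ∈ Icc (0 : ℝ) 1) :
    ‖loopPrimitive b₁ b₂ b₃ b₄ t‖ ≤ ‖b₁‖ + ‖b₂‖ + 3 * ‖b₃‖ + 4 * ‖b₄‖ := by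
  have p2 := pow_le_one₀ (n := 2) ht.1 ht.2
  have p3 := pow_le_one₀ (n := 3) ht.1 ht.2
  have p4 := pow_le_one₀ (n := 4) ht.1 ht.2
  have p5 := pow_le_one₀ (n := 5) ht.1 ht.2
  have n2 := pow_nonneg ht.1 2
  have n3 := pow_nonneg ht.1 3
  have n4 := pow_nonneg ht.1 4
  have n5 := pow_nonneg ht.1 5
  have a1 : |t - t ^ 2| ≤ 1 := by rw [abs_le]; constructor <;> linarith [ht.1, ht.2]
  have a2 : |t ^ 2 - t ^ 3| ≤ 1 := by rw [abs_le]; constructor <;> linarith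
  have a3 : |2 / 3 * t ^ 3 - 5 / 4 * t ^ 4 + 3 / 5 * t ^ 5| ≤ 3 := by
    rw [abs_le]; constructor <;> linarith
  have a4 : |(t - t ^ 2) * (t ^ 2 - t ^ 3) -
      (2 / 3 * t ^ 3 - 5 / 4 * t ^ 4 + 3 / 5 * t ^ 5)| ≤ 4 := by
    refine (abs_sub _ _).trans ?_
    rw [abs_mul]
    have := mul_le_one₀ a1 (abs_nonneg _) a2
    linarith
  have a5 : ∀ x : ℝ, |x| ≤ 1 → |x ^ 2 / 2| ≤ 1 := fun x hx => by
    rw [abs_div, abs_pow, abs_two]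
    have := pow_le_one₀ (n := 2) (abs_nonneg x) hx
    linarith
  refine (norm_add_le _ _).trans (add_le_add ((norm_add₃_le).trans
    (add_le_add_three ?_ ?_ ?_)) ?_) <;> rw [norm_smul]
  · exact mul_le_of_le_one_left (norm_nonneg _) (a5 _ a1)
  · exact mul_le_of_le_one_left (norm_nonneg _) (a5 _ a2)
  · exact mul_le_mul_of_nonneg_right a3 (norm_nonneg _)
  · exact mul_le_mul_of_nonneg_right a4 (norm_nonneg _)

theorem norm_smul_add_smul_le {h v : E} {a b : ℝ} (ha : |a| ≤ 1) (hb : |b| ≤ 1) :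
    ‖a • h + b • v‖ ≤ ‖h‖ + ‖v‖ := by
  refine (norm_add_le _ _).trans (add_le_add ?_ ?_)
  · exact (norm_smul a h).trans_le (mul_le_of_le_one_left (norm_nonneg _) ha)
  · exact (norm_smul b v).trans_le (mul_le_of_le_one_left (norm_nonneg _) hb)

/-- A smooth loop of size `ε` based at `c` in the plane spanned by `h` and `v`. -/
noncomputable def smallLoop (c h v : E) (ε t : ℝ) : E := c + ε • ((t - t ^ 2) • h + (t ^ 2 - t ^ 3) • v)

/-- The velocity of `smallLoop`. -/
noncomputable def smallLoopDeriv (h v : E) (ε t : ℝ) : E :=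
  ε • ((1 - 2 * t) • h + (2 * t - 3 * t ^ 2) • v)

theorem hasDerivAt_smallLoop (c h v : E) (ε t : ℝ) :
    HasDerivAt (smallLoop c h v ε) (smallLoopDeriv h v ε t) t := by
  exact ((((hasDerivAt_id_sub_sq t).smul_const h).add
    ((hasDerivAt_sq_sub_cube t).smul_const v)).const_smul ε).const_add c

theorem contDiff_smallLoop (c h v : E) (ε : ℝ) : ContDiff ℝ 1 (smallLoop c h v ε) := by
  unfold smallLoop
  fun_prop

@[simp] theorem smallLoop_zero (c h v : E) (ε : ℝ) : smallLoop c h v ε 0 = c := by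
  simp [smallLoop]

@[simp] theorem smallLoop_one (c h v : E) (ε : ℝ) : smallLoop c h v ε 1 = c := by
  simp [smallLoop]

variable {𝔸 : Type*} [NormedRing 𝔸] [NormedAlgebra ℝ 𝔸]

/-- With `a`, `b` the coordinates of the loop and `c`, `d` those of its velocity, this puts the
second order integrand in the form integrated by `loopPrimitive`. -/
theorem fderiv_add_mul_expand (D : E →L[ℝ] E →L[ℝ] 𝔸) (A : E →L[ℝ] 𝔸) (h v : E) (a b c d : ℝ) :
    D (a • h + b • v) (c • h + d • v) + A (c • h + d • v) * A (a • h + b • v) =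
      (a * c) • (D h h + A h * A h) + (b * d) • (D v v + A v * A v) +
        (a * d) • (D h v + A v * A h) + (b * c) • (D v h + A h * A v) := by
  have h1 : D (a • h + b • v) (c • h + d • v) =
      (a * c) • D h h + (b * d) • D v v + (a * d) • D h v + (b * c) • D v h := by
    simp only [map_add, map_smul, add_apply, smul_apply, smul_add, smul_smul]
    module
  have h2 : A (c • h + d • v) * A (a • h + b • v) =
      (a * c) • (A h * A h) + (b * d) • (A v * A v) +
        (a * d) • (A v * A h) + (b * c) • (A h * A v) := by
    simp only [map_add, map_smul, add_mul, mul_add, smul_mul_assoc, mul_smul_comm]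
    module
  rw [h1, h2]
  module

/-- If `g` is the parallel transport along the loop `c + ε u` and `g 1 = 1`, then the second order
term `Y` of the expansion of `g` in `ε` almost vanishes at time `1`. -/
theorem norm_secondOrder_le_of_closed {A : E → E →L[ℝ] 𝔸} {L : E →L[ℝ] E →L[ℝ] 𝔸} {c : E}
    {ε τ M ν β : ℝ} (hε : 0 < ε) (hετ : ε ≤ τ) (hM0 : 0 ≤ M) (hν0 : 0 ≤ ν) (hβ0 : 0 ≤ β)
    (hsmall : ε * (M * ν) ≤ 1)
    {u u' : ℝ → E} {Y : ℝ → 𝔸} {g : ℝ → 𝔸} (hud : ∀ t, HasDerivAt u (u' t) t)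
    (hYd : ∀ t, HasDerivAt Y (L (u t) (u' t) + A c (u' t) * A c (u t)) t)
    (hu0 : u 0 = 0) (hu1 : u 1 = 0) (hY0 : Y 0 = 0)
    (hu : ∀ t ∈ Icc (0 : ℝ) 1, ‖u t‖ ≤ ν) (hu' : ∀ t ∈ Icc (0 : ℝ) 1, ‖u' t‖ ≤ ν)
    (hYb : ∀ t ∈ Icc (0 : ℝ) 1, ‖Y t‖ ≤ β) (hMc : ‖A c‖ ≤ M)
    (hM : ∀ t ∈ Icc (0 : ℝ) 1, ‖A (c + ε • u t)‖ ≤ M)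
    (T1 : ∀ t ∈ Icc (0 : ℝ) 1, ‖A (c + ε • u t) - A c - L (ε • u t)‖ ≤ τ * ‖ε • u t‖)
    (T2 : ∀ t ∈ Icc (0 : ℝ) 1, ‖A (c + ε • u t) - A c‖ ≤ τ)
    (hg0 : g 0 = 1) (hg1 : g 1 = 1)
    (hg : ∀ t ∈ Icc (0 : ℝ) 1,
      HasDerivWithinAt g (A (c + ε • u t) (ε • u' t) * g t) (Icc 0 1) t) :
    ‖Y 1‖ ≤ 3 * (ν * ν + ν * (M * ν) + M * ν * β) * τ := by
  have hτ : 0 < τ := hε.trans_le hετ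
  have hεu : ∀ t ∈ Icc (0 : ℝ) 1, ‖ε • u t‖ ≤ ε * ν := fun t ht => by
    rw [norm_smul, Real.norm_of_nonneg hε.le]
    exact mul_le_mul_of_nonneg_left (hu t ht) hε.le
  have hεu' : ∀ t ∈ Icc (0 : ℝ) 1, ‖ε • u' t‖ ≤ ε * ν := fun t ht => by
    rw [norm_smul, Real.norm_of_nonneg hε.le]
    exact mul_le_mul_of_nonneg_left (hu' t ht) hε.le
  have ha : ∀ t ∈ Icc (0 : ℝ) 1, ‖A (c + ε • u t) (ε • u' t)‖ ≤ ε * (M * ν) := fun t ht => by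
    refine ((A _).le_opNorm _).trans ?_
    calc _ ≤ M * (ε * ν) := mul_le_mul (hM t ht) (hεu' t ht) (norm_nonneg _) hM0
      _ = _ := by ring
  -- The error of the second order expansion of the transport. As the loop and `g` are closed, its
  -- value at 1 is −ε² Y(1).
  let D : ℝ → 𝔸 := fun t => g t - (1 + A c (ε • u t) + ε ^ 2 • Y t)
  let D' : ℝ → 𝔸 := fun t => A (c + ε • u t) (ε • u' t) * g t -
    (A c (ε • u' t) + ε ^ 2 • (L (u t) (u' t) + A c (u' t) * A c (u t)))
  have hD : ∀ t ∈ Icc (0 : ℝ) 1, HasDerivWithinAt D (D' t) (Icc 0 1) t := by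
    intro t ht
    have d2 := (((A c).hasFDerivAt.comp_hasDerivAt t ((hud t).const_smul ε)).const_add 1).add
      ((hYd t).const_smul (ε ^ 2))
    exact (hg t ht).sub d2.hasDerivWithinAt
  have hb : ∀ t ∈ Icc (0 : ℝ) 1, ‖D' t - A (c + ε • u t) (ε • u' t) * D t‖ ≤
      ε ^ 2 * (τ * (ν * ν + ν * (M * ν) + M * ν * β)) := by
    intro t ht
    have key : D' t - A (c + ε • u t) (ε • u' t) * D t =
        (A (c + ε • u t) - A c - L (ε • u t)) (ε • u' t) +
        ((A (c + ε • u t) - A c) (ε • u' t)) * A c (ε • u t) +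
        ε ^ 2 • (A (c + ε • u t) (ε • u' t) * Y t) := by
      have e1 : L (ε • u t) (ε • u' t) = ε ^ 2 • L (u t) (u' t) := by
        simp only [map_smul, smul_apply, smul_smul, pow_two]
      have e2 : A c (ε • u' t) * A c (ε • u t) = ε ^ 2 • (A c (u' t) * A c (u t)) := by
        simp only [map_smul, smul_mul_assoc, mul_smul_comm, smul_smul, pow_two]
      simp only [D', D, sub_apply, e1, sub_mul, mul_sub, mul_add, mul_one, smul_add, ← e2,
        mul_smul_comm]
      abel
    rw [key]
    have m1 : ‖(A (c + ε • u t) - A c - L (ε • u t)) (ε • u' t)‖ ≤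
        (τ * (ε * ν)) * (ε * ν) := by
      refine (ContinuousLinearMap.le_opNorm _ _).trans
        (mul_le_mul ((T1 t ht).trans ?_) (hεu' t ht) (norm_nonneg _) (by positivity))
      exact mul_le_mul_of_nonneg_left (hεu t ht) hτ.le
    have m2 : ‖((A (c + ε • u t) - A c) (ε • u' t)) * A c (ε • u t)‖ ≤
        (τ * (ε * ν)) * (M * (ε * ν)) := by
      refine (norm_mul_le _ _).trans (mul_le_mul ?_ ?_ (norm_nonneg _) (by positivity))
      · exact (ContinuousLinearMap.le_opNorm _ _).trans
          (mul_le_mul (T2 t ht) (hεu' t ht) (norm_nonneg _) hτ.le)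
      · exact (ContinuousLinearMap.le_opNorm _ _).trans
          (mul_le_mul hMc (hεu t ht) (norm_nonneg _) hM0)
    -- This term is of third order in ε; the extra factor ε is traded for τ.
    have m3 : ‖ε ^ 2 • (A (c + ε • u t) (ε • u' t) * Y t)‖ ≤ ε ^ 2 * (τ * (M * ν) * β) := by
      rw [norm_smul, Real.norm_of_nonneg (by positivity)]
      refine mul_le_mul_of_nonneg_left ((norm_mul_le _ _).trans ?_) (by positivity)
      refine mul_le_mul ((ha t ht).trans ?_) (hYb t ht) (norm_nonneg _) (by positivity)
      exact mul_le_mul_of_nonneg_right hετ (by positivity)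
    refine (norm_add₃_le).trans ((add_le_add_three m1 m2 m3).trans (le_of_eq ?_))
    ring
  have hfin := norm_le_of_approx_linearODE (by positivity) hD
    (fun t ht => (ha t ht).trans hsmall) hb 1 (by simp)
  have hD0 : D 0 = 0 := by simp [D, hg0, hu0, hY0]
  have hD1 : D 1 = -(ε ^ 2 • Y 1) := by simp [D, hg1, hu1]
  rw [hD0, hD1, norm_neg, norm_smul, norm_zero, zero_add,
    Real.norm_of_nonneg (by positivity)] at hfin
  have hε2 : 0 < ε ^ 2 := by positivity
  refine le_of_mul_le_mul_left (hfin.trans (le_of_eq ?_)) hε2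
  ring

/-- If the holonomy along all small loops at `c` is trivial, then the curvature vanishes at `c`. -/
theorem curvature_eq_zero_of_smallLoop [CompleteSpace 𝔸] [ProperSpace E] {A : E → E →L[ℝ] 𝔸}
    {U : Set E} (hU : IsOpen U) (hA : ContDiffOn ℝ 1 A U) {c : E} {r : ℝ} (hr : 0 < r)
    (hrU : closedBall c r ⊆ U) (h v : E)
    (H : ∀ ε > 0, (∀ t ∈ Icc (0 : ℝ) 1, smallLoop c h v ε t ∈ closedBall c r) →
      ∀ g : ℝ → 𝔸, g 0 = 1 → (∀ t ∈ Icc (0 : ℝ) 1, HasDerivWithinAt g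
        (A (smallLoop c h v ε t) (smallLoopDeriv h v ε t) * g t) (Icc 0 1) t) → g 1 = 1) :
    fderiv ℝ A c h v - fderiv ℝ A c v h = A c h * A c v - A c v * A c h := by
  -- The antisymmetrization of `B` is the curvature at `c`.
  let B : E → E → 𝔸 := fun x y => fderiv ℝ A c x y + A c y * A c x
  suffices hX : B h v - B v h = 0 by
    rw [← sub_eq_zero, ← hX]; simp only [B]; abel
  obtain ⟨M, hM⟩ := (isCompact_closedBall c r).exists_bound_of_continuousOn
    (hA.continuousOn.mono hrU)
  have hcK : c ∈ closedBall c r := mem_closedBall_self hr.le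
  have hM0 : 0 ≤ M := (norm_nonneg _).trans (hM c hcK)
  obtain ⟨ν, hν⟩ : ∃ ν, ν = ‖h‖ + ‖v‖ := ⟨_, rfl⟩
  have hν0 : 0 ≤ ν := by rw [hν]; positivity
  let u : ℝ → E := fun t => (t - t ^ 2) • h + (t ^ 2 - t ^ 3) • v
  let u' : ℝ → E := fun t => (1 - 2 * t) • h + (2 * t - 3 * t ^ 2) • v
  have hud : ∀ t, HasDerivAt u (u' t) t := fun t =>
    ((hasDerivAt_id_sub_sq t).smul_const h).add ((hasDerivAt_sq_sub_cube t).smul_const v)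
  have hu : ∀ t ∈ Icc (0 : ℝ) 1, ‖u t‖ ≤ ν := fun t ht => by
    have h1 := ht.1
    have h2 := ht.2
    rw [hν]
    apply norm_smul_add_smul_le <;> rw [abs_le] <;> constructor <;>
      nlinarith [mul_nonneg h1 (sub_nonneg.2 h2), mul_nonneg (mul_nonneg h1 h1) (sub_nonneg.2 h2)]
  have hu' : ∀ t ∈ Icc (0 : ℝ) 1, ‖u' t‖ ≤ ν := fun t ht => by
    have h1 := ht.1
    have h2 := ht.2
    rw [hν]
    apply norm_smul_add_smul_le <;> rw [abs_le] <;> constructor <;>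
      nlinarith [mul_nonneg h1 (sub_nonneg.2 h2), sq_nonneg (t - 1)]
  obtain ⟨β, hβ⟩ : ∃ β, β = ‖B h h‖ + ‖B v v‖ + 3 * ‖B h v‖ + 4 * ‖B v h‖ := ⟨_, rfl⟩
  have hβ0 : 0 ≤ β := by rw [hβ]; positivity
  have hYd : ∀ t, HasDerivAt (loopPrimitive (B h h) (B v v) (B h v) (B v h))
      (fderiv ℝ A c (u t) (u' t) + A c (u' t) * A c (u t)) t := fun t =>
    (hasDerivAt_loopPrimitive _ _ _ _ t).congr_deriv
      (fderiv_add_mul_expand (fderiv ℝ A c) (A c) h v _ _ _ _).symm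
  have hYb : ∀ t ∈ Icc (0 : ℝ) 1,
      ‖loopPrimitive (B h h) (B v v) (B h v) (B v h) t‖ ≤ β := fun t ht =>
    (norm_loopPrimitive_le _ _ _ _ ht).trans hβ.ge
  have hle : ∀ τ > 0, ‖(1 / 60 : ℝ) • (B h v - B v h)‖ ≤
      3 * (ν * ν + ν * (M * ν) + M * ν * β) * τ := by
    intro τ hτ
    obtain ⟨δ, hδ, T⟩ := hA.exists_uniform_taylor hU (isCompact_closedBall c r)
      (convex_closedBall c r) hrU hτ
    have hsmall : ∀ a b : ℝ, 0 < b → ∀ᶠ ε in 𝓝[>] (0 : ℝ), ε * a < b := by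
      intro a b hb
      have : Tendsto (fun ε : ℝ => ε * a) (𝓝[>] 0) (𝓝 (0 * a)) :=
        (Continuous.tendsto (by fun_prop) 0).mono_left nhdsWithin_le_nhds
      rw [zero_mul] at this
      exact this.eventually (gt_mem_nhds hb)
    -- The conditions on ε keep the loop in the ball, keep it in the range of the Taylor estimate,
    -- give ε < τ, and make the transport equation solvable on [0, 1].
    obtain ⟨ε, ⟨⟨⟨hε1, hε2⟩, hε3⟩, hε4⟩, hε⟩ := ((((hsmall ν r hr).and (hsmall ν δ hδ)).and
      (hsmall 1 τ hτ)).and (hsmall (M * ν * (‖(1 : 𝔸)‖ + 1)) 1 one_pos)).and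
      (self_mem_nhdsWithin) |>.exists
    rw [mul_one] at hε3
    have hε : 0 < ε := hε
    have hεu : ∀ t ∈ Icc (0 : ℝ) 1, ‖ε • u t‖ ≤ ε * ν := fun t ht => by
      rw [norm_smul, Real.norm_of_nonneg hε.le]
      exact mul_le_mul_of_nonneg_left (hu t ht) hε.le
    have hmem : ∀ t ∈ Icc (0 : ℝ) 1, c + ε • u t ∈ closedBall c r := fun t ht => by
      rw [mem_closedBall_iff_norm, add_sub_cancel_left]
      exact (hεu t ht).trans hε1.le
    have haκ : ∀ t ∈ Icc (0 : ℝ) 1,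
        ‖A (c + ε • u t) (ε • u' t)‖ * (‖(1 : 𝔸)‖ + 1) ≤ 1 := fun t ht => by
      refine le_trans ?_ hε4.le
      calc _ ≤ (M * (ε * ν)) * (‖(1 : 𝔸)‖ + 1) := by
            refine mul_le_mul_of_nonneg_right (((A _).le_opNorm _).trans ?_) (by positivity)
            refine mul_le_mul (hM _ (hmem t ht)) ?_ (norm_nonneg _) hM0
            rw [norm_smul, Real.norm_of_nonneg hε.le]
            exact mul_le_mul_of_nonneg_left (hu' t ht) hε.le
        _ = _ := by ring
    have huc : Continuous u := by simp only [u]; fun_prop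
    have huc' : Continuous u' := by simp only [u']; fun_prop
    have hac : ContinuousOn (fun t => A (c + ε • u t) (ε • u' t)) (Icc 0 1) := by
      refine ContinuousOn.clm_apply ?_ (huc'.const_smul ε).continuousOn
      exact hA.continuousOn.comp ((huc.const_smul ε).const_add c).continuousOn
        fun t ht => hrU (hmem t ht)
    obtain ⟨g, hg0, hg⟩ := exists_linearODE_solution hac haκ
    have hg1 : g 1 = 1 := H ε hε hmem g hg0 hg
    have hsm : ε * (M * ν) ≤ 1 := by
      refine le_trans (le_of_le_of_eq (le_mul_of_one_le_right (by positivity) ?_) (mul_assoc _ _ _))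
        hε4.le
      linarith [norm_nonneg (1 : 𝔸)]
    have := norm_secondOrder_le_of_closed hε hε3.le hM0 hν0 hβ0 hsm hud hYd (by simp [u])
      (by simp [u]) (loopPrimitive_zero _ _ _ _) hu hu' hYb (hM c hcK)
      (fun t ht => hM _ (hmem t ht))
      (fun t ht => (T c hcK _ (hmem t ht) ((hεu t ht).trans_lt hε2)).1)
      (fun t ht => (T c hcK _ (hmem t ht) ((hεu t ht).trans_lt hε2)).2) hg0 hg1 hg
    rwa [loopPrimitive_one] at this
  have h0 : ‖(1 / 60 : ℝ) • (B h v - B v h)‖ ≤ 0 := by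
    refine ge_of_tendsto (x := 𝓝[>] (0 : ℝ))
      (f := fun τ => 3 * (ν * ν + ν * (M * ν) + M * ν * β) * τ) ?_ ?_
    · have : Tendsto (fun τ : ℝ => 3 * (ν * ν + ν * (M * ν) + M * ν * β) * τ) (𝓝[>] 0)
          (𝓝 (3 * (ν * ν + ν * (M * ν) + M * ν * β) * 0)) :=
        (Continuous.tendsto (by fun_prop) 0).mono_left nhdsWithin_le_nhds
      simpa using this
    · filter_upwards [self_mem_nhdsWithin] with τ hτ using hle τ hτ
  exact (smul_eq_zero.1 (norm_le_zero_iff.1 h0)).resolve_left (by norm_num)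

end SmallLoop

/-! ### The Lyapunov connection form and its curvature -/

section Lyapunov

variable {𝔸 : Type*} [NormedRing 𝔸] [NormedAlgebra ℝ 𝔸]
  {E : Type*} [NormedAddCommGroup E] [NormedSpace ℝ E]

variable (𝔸) in
/-- The anticommutator `L ↦ L ρ + ρ L`, as a continuous linear function of `ρ`. -/
noncomputable def anticomm : 𝔸 →L[ℝ] 𝔸 →L[ℝ] 𝔸 :=
  (ContinuousLinearMap.mul ℝ 𝔸).flip + ContinuousLinearMap.mul ℝ 𝔸

theorem anticomm_apply (ρ L : 𝔸) : anticomm 𝔸 ρ L = L * ρ + ρ * L := rfl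

/-- The Lyapunov connection form of a family `ρ`: its value `A` on the tangent vector `v` is the
solution of `A ρ + ρ A = dρ v`. -/
noncomputable def lyapunovConnection (ρ : E → 𝔸) (θ : E) : E →L[ℝ] 𝔸 :=
  (anticomm 𝔸 (ρ θ)).inverse.comp (fderiv ℝ ρ θ)

/-- The curvature of the Lyapunov connection form. -/
noncomputable def lyapunovCurvature (ρ : E → 𝔸) (θ h v : E) : 𝔸 :=
  fderiv ℝ (lyapunovConnection ρ) θ h v - fderiv ℝ (lyapunovConnection ρ) θ v h -
    (lyapunovConnection ρ θ h * lyapunovConnection ρ θ v -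
      lyapunovConnection ρ θ v * lyapunovConnection ρ θ h)

/-- A twice continuously differentiable family of invertible self-adjoint elements whose
anticommutators are injective. -/
structure IsFaithfulFamily [StarRing 𝔸] (ρ : E → 𝔸) (U : Set E) : Prop where
  isOpen : IsOpen U
  contDiffOn : ContDiffOn ℝ 2 ρ U
  star_eq : ∀ θ ∈ U, star (ρ θ) = ρ θ
  isUnit : ∀ θ ∈ U, IsUnit (ρ θ)
  anticomm_injective : ∀ θ ∈ U, ∀ L, L * ρ θ + ρ θ * L = 0 → L = 0

namespace IsFaithfulFamily

variable [StarRing 𝔸] {ρ : E → 𝔸} {U : Set E} (hρ : IsFaithfulFamily ρ U) {θ : E}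

include hρ

theorem hasFDerivAt (hθ : θ ∈ U) : HasFDerivAt ρ (fderiv ℝ ρ θ) θ :=
  ((hρ.contDiffOn.differentiableOn (by norm_num)).differentiableAt
    (hρ.isOpen.mem_nhds hθ)).hasFDerivAt

theorem star_fderiv [ContinuousStar 𝔸] [StarModule ℝ 𝔸] (hθ : θ ∈ U) (v : E) :
    star (fderiv ℝ ρ θ v) = fderiv ℝ ρ θ v := by
  have h1 := (hρ.hasFDerivAt hθ).star
  have h2 : (fun x => star (ρ x)) =ᶠ[𝓝 θ] ρ := by
    filter_upwards [hρ.isOpen.mem_nhds hθ] with x hx using hρ.star_eq x hx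
  exact DFunLike.congr_fun ((h1.congr_of_eventuallyEq h2.symm).unique (hρ.hasFDerivAt hθ)) v

variable [FiniteDimensional ℝ 𝔸]

theorem isInvertible_anticomm (hθ : θ ∈ U) : (anticomm 𝔸 (ρ θ)).IsInvertible := by
  have hinj : Function.Injective (anticomm 𝔸 (ρ θ) : 𝔸 →ₗ[ℝ] 𝔸) :=
    (injective_iff_map_eq_zero _).2 fun L hL => hρ.anticomm_injective θ hθ L hL
  refine ⟨(LinearEquiv.ofInjectiveEndo _ hinj).toContinuousLinearEquiv, ?_⟩
  ext1 L
  rfl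

theorem connection_mul_add (hθ : θ ∈ U) (v : E) :
    lyapunovConnection ρ θ v * ρ θ + ρ θ * lyapunovConnection ρ θ v = fderiv ℝ ρ θ v := by
  rw [← anticomm_apply, lyapunovConnection]
  obtain ⟨e, he⟩ := hρ.isInvertible_anticomm hθ
  rw [← he, ContinuousLinearMap.inverse_equiv]
  exact e.apply_symm_apply _

theorem eq_connection (hθ : θ ∈ U) {v : E} {L : 𝔸} (hL : L * ρ θ + ρ θ * L = fderiv ℝ ρ θ v) :
    L = lyapunovConnection ρ θ v := by
  rw [← sub_eq_zero]
  refine hρ.anticomm_injective θ hθ _ ?_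
  rw [sub_mul, mul_sub, sub_add_sub_comm, hρ.connection_mul_add hθ, hL, sub_self]

theorem star_connection [ContinuousStar 𝔸] [StarModule ℝ 𝔸] (hθ : θ ∈ U) (v : E) :
    star (lyapunovConnection ρ θ v) = lyapunovConnection ρ θ v := by
  refine hρ.eq_connection hθ ?_
  rw [← hρ.star_fderiv hθ, ← hρ.connection_mul_add hθ, star_add, star_mul, star_mul,
    hρ.star_eq θ hθ, add_comm]

/-- Inversion of continuous linear maps is smooth at invertible ones; the one lost order of
smoothness comes from `dρ`. -/
theorem contDiffOn_connection : ContDiffOn ℝ 1 (lyapunovConnection ρ) U := by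
  have : CompleteSpace 𝔸 := FiniteDimensional.complete ℝ 𝔸
  refine ContDiffOn.clm_comp (fun θ hθ => ContDiffAt.contDiffWithinAt ?_)
    (hρ.contDiffOn.fderiv_of_isOpen hρ.isOpen (by norm_num))
  have h1 := (hρ.isInvertible_anticomm hθ).contDiffAt_map_inverse (n := 1)
  have h2 : ContDiffAt ℝ 1 (fun θ => anticomm 𝔸 (ρ θ)) θ :=
    (anticomm 𝔸).contDiff.contDiffAt.comp θ
      ((hρ.contDiffOn.contDiffAt (hρ.isOpen.mem_nhds hθ)).of_le (by norm_num))
  exact h1.comp θ h2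

theorem hasFDerivAt_connection_apply (hθ : θ ∈ U) (v : E) :
    HasFDerivAt (fun x => lyapunovConnection ρ x v)
      ((ContinuousLinearMap.apply ℝ 𝔸 v).comp (fderiv ℝ (lyapunovConnection ρ) θ)) θ :=
  (ContinuousLinearMap.apply ℝ 𝔸 v).hasFDerivAt.comp θ
    ((hρ.contDiffOn_connection.differentiableOn (by norm_num)).differentiableAt
      (hρ.isOpen.mem_nhds hθ)).hasFDerivAt

/-- Product rule for dρ(v) = A(v)ρ + ρA(v), which holds in a neighbourhood of `θ`. -/
theorem fderiv_fderiv_apply (hθ : θ ∈ U) (h v : E) :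
    fderiv ℝ (fderiv ℝ ρ) θ h v =
      (lyapunovConnection ρ θ v * fderiv ℝ ρ θ h +
        fderiv ℝ (lyapunovConnection ρ) θ h v * ρ θ) +
      (ρ θ * fderiv ℝ (lyapunovConnection ρ) θ h v +
        fderiv ℝ ρ θ h * lyapunovConnection ρ θ v) := by
  have h1 := hρ.hasFDerivAt_connection_apply hθ v
  have h2 := (h1.mul' (hρ.hasFDerivAt hθ)).add ((hρ.hasFDerivAt hθ).mul' h1)
  have h3 : DifferentiableAt ℝ (fderiv ℝ ρ) θ :=
    ((hρ.contDiffOn.fderiv_of_isOpen (m := 1) hρ.isOpen (by norm_num)).differentiableOn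
      (by norm_num)).differentiableAt (hρ.isOpen.mem_nhds hθ)
  have h4 : HasFDerivAt (fun x => fderiv ℝ ρ x v)
      ((ContinuousLinearMap.apply ℝ 𝔸 v).comp (fderiv ℝ (fderiv ℝ ρ) θ)) θ :=
    (ContinuousLinearMap.apply ℝ 𝔸 v).hasFDerivAt.comp θ h3.hasFDerivAt
  have h5 : (fun x => fderiv ℝ ρ x v) =ᶠ[𝓝 θ]
      fun x => lyapunovConnection ρ x v * ρ x + ρ x * lyapunovConnection ρ x v := by
    filter_upwards [hρ.isOpen.mem_nhds hθ] with x hx using (hρ.connection_mul_add hx v).symm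
  exact DFunLike.congr_fun (h4.unique (h2.congr_of_eventuallyEq h5)) h

/-- The Lyapunov equation relating the curvature to the commutators of the connection form. -/
theorem curvature_anticomm (hθ : θ ∈ U) (h v : E) :
    lyapunovCurvature ρ θ h v * ρ θ + ρ θ * lyapunovCurvature ρ θ h v =
      -((2 : ℝ) • (ρ θ * (lyapunovConnection ρ θ h * lyapunovConnection ρ θ v -
        lyapunovConnection ρ θ v * lyapunovConnection ρ θ h))) := by
  have hs : fderiv ℝ (fderiv ℝ ρ) θ h v = fderiv ℝ (fderiv ℝ ρ) θ v h :=
    ((hρ.contDiffOn.contDiffAt (hρ.isOpen.mem_nhds hθ)).isSymmSndFDerivAt (by simp)).eq h v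
  rw [hρ.fderiv_fderiv_apply hθ, hρ.fderiv_fderiv_apply hθ, ← hρ.connection_mul_add hθ,
    ← hρ.connection_mul_add hθ, ← sub_eq_zero] at hs
  rw [← sub_eq_zero, ← hs, lyapunovCurvature, two_smul]
  noncomm_ring

/-- In `curvature_anticomm`, invertibility of ρ removes the factor ρ on the right, and injectivity
of the anticommutator removes it on the left. -/
theorem curvature_eq_zero_iff (hθ : θ ∈ U) (h v : E) :
    lyapunovCurvature ρ θ h v = 0 ↔
      Commute (lyapunovConnection ρ θ h) (lyapunovConnection ρ θ v) := by
  have key := hρ.curvature_anticomm hθ h v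
  constructor
  · intro h0
    rw [h0, zero_mul, mul_zero, add_zero, eq_comm, neg_eq_zero, smul_eq_zero] at key
    exact sub_eq_zero.1 (((hρ.isUnit θ hθ).mul_right_eq_zero).1 (key.resolve_left two_ne_zero))
  · intro hc
    rw [hc.eq, sub_self, mul_zero, smul_zero, neg_zero] at key
    exact hρ.anticomm_injective θ hθ _ key

theorem isFlatOn_connection
    (hc : ∀ θ ∈ U, ∀ h v, Commute (lyapunovConnection ρ θ h) (lyapunovConnection ρ θ v)) :
    IsFlatOn (lyapunovConnection ρ) U := fun θ hθ h v =>
  sub_eq_zero.1 ((hρ.curvature_eq_zero_iff hθ h v).2 (hc θ hθ h v))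

/-- A curve that is horizontal for the Lyapunov connection stays over the family if it starts
over it. -/
theorem mul_star_eq [ContinuousStar 𝔸] [StarModule ℝ 𝔸] {γ γ' : ℝ → E} {W : ℝ → 𝔸}
    (hγ : ∀ t ∈ Icc (0 : ℝ) 1, HasDerivWithinAt γ (γ' t) (Icc 0 1) t)
    (hγ' : ContinuousOn γ' (Icc 0 1)) (hγU : ∀ t ∈ Icc (0 : ℝ) 1, γ t ∈ U)
    (hW : ∀ t ∈ Icc (0 : ℝ) 1,
      HasDerivWithinAt W (lyapunovConnection ρ (γ t) (γ' t) * W t) (Icc 0 1) t)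
    (h0 : W 0 * star (W 0) = ρ (γ 0)) :
    ∀ t ∈ Icc (0 : ℝ) 1, W t * star (W t) = ρ (γ t) := by
  have hac : ContinuousOn (fun t => lyapunovConnection ρ (γ t) (γ' t)) (Icc 0 1) :=
    (hρ.contDiffOn_connection.continuousOn.comp (fun t ht => (hγ t ht).continuousWithinAt)
      hγU).clm_apply hγ'
  obtain ⟨K, hK⟩ := isCompact_Icc.exists_bound_of_continuousOn hac
  -- The defect D = WW* − ρ satisfies the homogeneous linear equation D' = AD + DA, since `A` is
  -- self-adjoint; starting at zero, it stays zero.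
  have hD : ∀ t ∈ Icc (0 : ℝ) 1, HasDerivWithinAt (fun t => W t * star (W t) - ρ (γ t))
      (lyapunovConnection ρ (γ t) (γ' t) * (W t * star (W t) - ρ (γ t)) +
        (W t * star (W t) - ρ (γ t)) * lyapunovConnection ρ (γ t) (γ' t)) (Icc 0 1) t := by
    intro t ht
    have h1 := (hW t ht).mul (hW t ht).star
    have h2 := (hρ.hasFDerivAt (hγU t ht)).comp_hasDerivWithinAt t (hγ t ht)
    refine (h1.sub h2).congr_deriv ?_
    rw [← hρ.connection_mul_add (hγU t ht), star_mul, hρ.star_connection (hγU t ht)]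
    noncomm_ring
  intro t ht
  refine sub_eq_zero.1 (eq_zero_of_abs_deriv_le_mul_abs_self_of_eq_zero_right (K := 2 * K)
    (fun s hs => (hD s hs).continuousWithinAt)
    (fun s hs => (hD s (Ico_subset_Icc_self hs)).mono_of_mem_nhdsWithin
      (Icc_mem_nhdsGE_of_mem hs)) (by rw [h0, sub_self]) (fun s hs => ?_) t ht)
  have hs' := hK s (Ico_subset_Icc_self hs)
  refine (norm_add_le _ _).trans ?_
  have h1 := (norm_mul_le (lyapunovConnection ρ (γ s) (γ' s))
    (W s * star (W s) - ρ (γ s))).trans (mul_le_mul_of_nonneg_right hs' (norm_nonneg _))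
  have h2 := (norm_mul_le (W s * star (W s) - ρ (γ s))
    (lyapunovConnection ρ (γ s) (γ' s))).trans (mul_le_mul_of_nonneg_left hs' (norm_nonneg _))
  linarith

end IsFaithfulFamily

end Lyapunov

/-! ### Application to quantum models and relative phase factors -/

namespace QuantumEstimation

variable {n m : ℕ}

theorem half_smul_eq (X : Matrix (Fin n) (Fin n) ℂ) : (1 / 2 : ℂ) • X = (1 / 2 : ℝ) • X := by
  ext i j
  simp [Matrix.smul_apply, Complex.real_smul]

instance continuousStar_matrix : @ContinuousStar (Matrix (Fin n) (Fin n) ℂ)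
    PseudoMetricSpace.toUniformSpace.toTopologicalSpace _ :=
  instContinuousStarMatrix

open scoped MatrixOrder in
theorem exists_eq_conjTranspose_mul_self {ρ : Matrix (Fin n) (Fin n) ℂ} (hρ : ρ.PosSemidef) :
    ∃ B, ρ = Bᴴ * B :=
  CStarAlgebra.nonneg_iff_eq_star_mul_self.1 hρ.nonneg

/-- As W₀†W₀ is positive definite, W₀ serves as the in-phase point over the common state. The
relative phase factor is then W₀⁻¹W₁, by uniqueness. -/
theorem isRelativePhaseFactor_one_iff {W₀ W₁ : Matrix (Fin n) (Fin n) ℂ}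
    (h₀ : (W₀ * W₀ᴴ).PosDef) (h₁ : W₁ * W₁ᴴ = W₀ * W₀ᴴ) :
    IsRelativePhaseFactor W₀ W₁ 1 ↔ W₁ = W₀ := by
  have hu : IsUnit W₀ := by
    rw [Matrix.isUnit_iff_isUnit_det]
    have := (Matrix.isUnit_iff_isUnit_det _).1 h₀.isUnit
    rw [Matrix.det_mul] at this
    exact isUnit_of_mul_isUnit_left this
  have hdet := (Matrix.isUnit_iff_isUnit_det _).1 hu
  have hpos : (W₀ᴴ * W₀).PosDef :=
    Matrix.PosDef.conjTranspose_mul_self _ (Matrix.mulVec_injective_of_isUnit hu)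
  constructor
  · intro h
    have hW : W₁ = W₀ * (W₀⁻¹ * W₁) := by
      rw [← Matrix.mul_assoc, Matrix.mul_nonsing_inv _ hdet, Matrix.one_mul]
    have hU : W₀⁻¹ * W₁ ∈ Matrix.unitaryGroup (Fin n) ℂ := by
      rw [Matrix.mem_unitaryGroup_iff, Matrix.star_eq_conjTranspose, Matrix.conjTranspose_mul,
        Matrix.mul_assoc, ← Matrix.mul_assoc W₁, h₁, Matrix.mul_assoc W₀,
        ← Matrix.conjTranspose_mul, Matrix.nonsing_inv_mul _ hdet, Matrix.conjTranspose_one,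
        Matrix.mul_one, Matrix.nonsing_inv_mul _ hdet]
    have := h.unique ⟨hU, W₀, h₁.symm, hpos, hW⟩
    rw [hW, ← this, Matrix.mul_one]
  · rintro rfl
    exact ⟨one_mem _, W₁, rfl, hpos, (Matrix.mul_one _).symm⟩

theorem IsPiecewiseC1.differentiableAt {c : ℝ → Fin m → ℝ} (hc : IsPiecewiseC1 c) :
    ∃ S : Finset ℝ, ∀ t ∈ Ioo (0 : ℝ) 1, t ∉ S → DifferentiableAt ℝ c t := by
  obtain ⟨k, t, -, h0, h1, hd⟩ := hc
  refine ⟨Finset.univ.image t, fun s hs hsS => ?_⟩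
  have hne : ∀ i, t i ≠ s := fun i h => hsS (Finset.mem_image.2 ⟨i, Finset.mem_univ _, h⟩)
  -- If no open subinterval contained `s`, induction would put every node below `s`, including the
  -- last one, which is 1.
  obtain ⟨i, hi⟩ : ∃ i : Fin k, t i.castSucc < s ∧ s < t i.succ := by
    by_contra! hcon
    have hall : ∀ i, t i < s := fun i => by
      induction i using Fin.induction with
      | zero => rw [h0]; exact hs.1
      | succ i ih => exact (hcon i ih).lt_of_ne (hne _)
    have := hall (Fin.last k)
    rw [h1] at this
    exact lt_asymm this hs.2
  exact ((hd i).differentiableOn (by norm_num)).differentiableAt (Icc_mem_nhds hi.1 hi.2)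

namespace Model

variable (M : Model n m)

theorem isFaithfulFamily : IsFaithfulFamily M.ρ M.Θ where
  isOpen := M.isOpen_Θ
  contDiffOn := M.contDiffOn_ρ
  star_eq θ hθ := (M.posDef_ρ θ hθ).isHermitian
  isUnit θ hθ := (M.posDef_ρ θ hθ).isUnit
  anticomm_injective θ hθ _ hL := eq_zero_of_anticomm (M.posDef_ρ θ hθ) hL

variable {M} {θ : Fin m → ℝ}

/-- The bridge from SLDs to the connection form, by uniqueness for the Lyapunov equation. Leaving
`X` free lets it serve both partial derivatives and velocities of state curves. -/
theorem half_smul_sld (hθ : θ ∈ M.Θ) {v : Fin m → ℝ} {X : Matrix (Fin n) (Fin n) ℂ}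
    (hX : X = fderiv ℝ M.ρ θ v) :
    (1 / 2 : ℝ) • sld (M.ρ θ) X = lyapunovConnection M.ρ θ v := by
  have hH : X.IsHermitian := by
    rw [hX]; exact M.isFaithfulFamily.star_fderiv hθ v
  refine M.isFaithfulFamily.eq_connection hθ ?_
  have h1 := (isSLD_sld (M.posDef_ρ θ hθ) hH).2
  rw [half_smul_eq, smul_add, ← smul_mul_assoc, ← mul_smul_comm] at h1
  rw [← h1]
  exact hX

theorem L_eq (hθ : θ ∈ M.Θ) (i : Fin m) :
    M.L i θ = (2 : ℝ) • lyapunovConnection M.ρ θ (Pi.single i 1) := by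
  rw [← half_smul_sld (X := partialDeriv i M.ρ θ) hθ rfl, smul_smul, L]
  norm_num

theorem partialDeriv_L (hθ : θ ∈ M.Θ) (i j : Fin m) :
    partialDeriv i (M.L j) θ =
      (2 : ℝ) • fderiv ℝ (lyapunovConnection M.ρ) θ (Pi.single i 1) (Pi.single j 1) := by
  have h1 := (M.isFaithfulFamily.hasFDerivAt_connection_apply hθ (Pi.single j 1)).const_smul (2 : ℝ)
  have h2 : M.L j =ᶠ[𝓝 θ] fun x => (2 : ℝ) • lyapunovConnection M.ρ x (Pi.single j 1) := by
    filter_upwards [M.isOpen_Θ.mem_nhds hθ] with x hx using L_eq hx j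
  exact DFunLike.congr_fun (h1.congr_of_eventuallyEq h2).fderiv (Pi.single i 1)

theorem F_eq (hθ : θ ∈ M.Θ) (i j : Fin m) :
    M.F i j θ = (2 : ℝ) • lyapunovCurvature M.ρ θ (Pi.single i 1) (Pi.single j 1) := by
  rw [F, partialDeriv_L hθ, partialDeriv_L hθ, L_eq hθ, L_eq hθ, half_smul_eq, lyapunovCurvature]
  simp only [smul_mul_assoc, mul_smul_comm, smul_sub, smul_smul]
  norm_num

theorem commute_L_iff (hθ : θ ∈ M.Θ) (i j : Fin m) : Commute (M.L i θ) (M.L j θ) ↔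
    Commute (lyapunovConnection M.ρ θ (Pi.single i 1))
      (lyapunovConnection M.ρ θ (Pi.single j 1)) := by
  rw [L_eq hθ, L_eq hθ]
  exact (Commute.smul_left_iff₀ two_ne_zero).trans (Commute.smul_right_iff₀ two_ne_zero)

theorem locallyQuasiClassicalAt_iff_F (hθ : θ ∈ M.Θ) :
    M.LocallyQuasiClassicalAt θ ↔ ∀ i j : Fin m, M.F i j θ = 0 := by
  refine forall_congr' fun i => forall_congr' fun j => ?_
  rw [commute_L_iff hθ, F_eq hθ, ← M.isFaithfulFamily.curvature_eq_zero_iff hθ, smul_eq_zero]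
  simp

/-- Commutation on coordinate vectors extends to all tangent vectors by bilinearity. -/
theorem LocallyQuasiClassicalAt.commute_connection (hθ : θ ∈ M.Θ)
    (h : M.LocallyQuasiClassicalAt θ) (v w : Fin m → ℝ) :
    Commute (lyapunovConnection M.ρ θ v) (lyapunovConnection M.ρ θ w) := by
  have hexp : ∀ v : Fin m → ℝ, lyapunovConnection M.ρ θ v =
      ∑ i, v i • lyapunovConnection M.ρ θ (Pi.single i 1) := by
    intro v
    conv_lhs => rw [← Finset.univ_sum_single v]
    rw [map_sum]
    refine Finset.sum_congr rfl fun i _ => ?_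
    rw [← map_smul, ← Pi.single_smul, smul_eq_mul, mul_one]
  rw [hexp v, hexp w]
  refine Commute.sum_left _ _ _ fun i _ => Commute.sum_right _ _ _ fun j _ => ?_
  exact (((commute_L_iff hθ i j).1 (h i j)).smul_left _).smul_right _

theorem hasDerivAt_stateCurve {x y : M.Θ} (γ : Path x y) {t : ℝ} {w : Fin m → ℝ}
    (hw : HasDerivAt (M.curve γ) w t) :
    HasDerivAt (M.stateCurve γ) (fderiv ℝ M.ρ (γ.extend t) w) t :=
  (M.isFaithfulFamily.hasFDerivAt (γ.extend t).2).comp_hasDerivAt t hw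

theorem half_smul_sld_stateCurve {x y : M.Θ} (γ : Path x y) {t : ℝ} {w : Fin m → ℝ}
    (hw : HasDerivAt (M.curve γ) w t) (X : Matrix (Fin n) (Fin n) ℂ) :
    (1 / 2 : ℂ) • (sld (M.stateCurve γ t) (deriv (M.stateCurve γ) t) * X) =
      lyapunovConnection M.ρ (γ.extend t) w * X := by
  rw [half_smul_eq, ← smul_mul_assoc]
  congr 1
  exact half_smul_sld (γ.extend t).2 (hasDerivAt_stateCurve γ hw).deriv

/-- Relative phase factors of a locally quasi-classical model vanish along null-homotopic loops. -/
theorem relativePhaseFactorVanishes_of_homotopic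
    (h : ∀ θ ∈ M.Θ, M.LocallyQuasiClassicalAt θ) {x : M.Θ} {γ : Path x x}
    (hγ : IsPiecewiseC1 (M.curve γ)) (hhom : γ.Homotopic (Path.refl x)) :
    RelativePhaseFactorVanishes (M.stateCurve γ) := by
  intro W hW
  have hx0 : M.stateCurve γ 0 = M.ρ x := by simp [stateCurve, curve]
  have hx1 : M.stateCurve γ 1 = M.ρ x := by simp [stateCurve, curve]
  have e0 := hW.lift 0 (by simp)
  have e1 := hW.lift 1 (by simp)
  rw [hx0] at e0
  rw [hx1] at e1
  rw [isRelativePhaseFactor_one_iff (e0 ▸ M.posDef_ρ x x.2) (e1.symm.trans e0)]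
  obtain ⟨S₁, hS₁⟩ := hW.horizontal
  obtain ⟨S₂, hS₂⟩ := hγ.differentiableAt
  refine (M.isFaithfulFamily.isFlatOn_connection
    fun θ hθ => (h θ hθ).commute_connection hθ).eq_of_homotopic_refl M.isOpen_Θ
    M.isFaithfulFamily.contDiffOn_connection hhom hW.continuousOn (S₁ ∪ S₂) fun t ht htS => ?_
  rw [Finset.notMem_union] at htS
  have hd := (hS₂ t ht htS.2).hasDerivAt
  refine ⟨_, hd, ?_⟩
  have := hS₁ t ht htS.1
  rw [half_smul_sld_stateCurve γ hd] at this
  exact this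

/-- If relative phase factors vanish along null-homotopic loops, the model is locally
quasi-classical. -/
theorem locallyQuasiClassicalAt_of_vanishes
    (H : ∀ (x : M.Θ) (γ : Path x x), IsPiecewiseC1 (M.curve γ) →
      Path.Homotopic γ (Path.refl x) → RelativePhaseFactorVanishes (M.stateCurve γ))
    (hθ : θ ∈ M.Θ) : M.LocallyQuasiClassicalAt θ := by
  intro i j
  rw [commute_L_iff hθ, ← M.isFaithfulFamily.curvature_eq_zero_iff hθ, lyapunovCurvature,
    sub_eq_zero]
  obtain ⟨r, hr, hrΘ⟩ := Metric.nhds_basis_closedBall.mem_iff.1 (M.isOpen_Θ.mem_nhds hθ)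
  refine curvature_eq_zero_of_smallLoop M.isOpen_Θ M.isFaithfulFamily.contDiffOn_connection hr hrΘ
    _ _ fun ε hε hmem g hg0 hg => ?_
  set h : Fin m → ℝ := Pi.single i 1
  set v : Fin m → ℝ := Pi.single j 1
  let x : M.Θ := ⟨θ, hθ⟩
  have hcont := (contDiff_smallLoop θ h v ε).continuous
  let γ : Path x x :=
    { toFun := fun t => ⟨smallLoop θ h v ε t, hrΘ (hmem t t.2)⟩
      continuous_toFun := (hcont.comp continuous_subtype_val).subtype_mk _
      source' := Subtype.ext (smallLoop_zero θ h v ε)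
      target' := Subtype.ext (smallLoop_one θ h v ε) }
  have hcurve : ∀ t ∈ Icc (0 : ℝ) 1, M.curve γ t = smallLoop θ h v ε t := fun t ht => by
    rw [curve, Path.extend_apply _ ht]
    rfl
  have hC1 : IsPiecewiseC1 (M.curve γ) := by
    -- One interval suffices: the curve equals the smooth loop on [0, 1], and its constant extension
    -- beyond plays no role.
    refine ⟨1, ![0, 1], ?_, rfl, rfl, fun k => ?_⟩
    · rw [Fin.monotone_iff_le_succ]
      intro k
      fin_cases k
      simp
    · fin_cases k
      exact (contDiff_smallLoop θ h v ε).contDiffOn.congr hcurve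
  have hhom : γ.Homotopic (Path.refl x) := by
    refine ⟨{
      -- Straight-line contraction to `θ` within the closed ball.
      toFun := fun p => ⟨θ + (1 - (p.1 : ℝ)) • (smallLoop θ h v ε p.2 - θ), hrΘ ?_⟩
      continuous_toFun := ?_
      map_zero_left := fun t => Subtype.ext (by simp [γ])
      map_one_left := fun t => Subtype.ext (by simp [x])
      prop' := ?_ }⟩
    · exact (convex_closedBall θ r).add_smul_sub_mem (mem_closedBall_self hr.le)
        (hmem p.2 p.2.2) ⟨sub_nonneg.2 p.1.2.2, sub_le_self _ p.1.2.1⟩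
    · exact Continuous.subtype_mk (by fun_prop) _
    · rintro s t (rfl | rfl) <;> exact Subtype.ext (by simp [x])
  obtain ⟨B, hB⟩ := exists_eq_conjTranspose_mul_self (M.posDef_ρ θ hθ).posSemidef
  -- Since ρ(θ) = B†B, the matrix B† lies over ρ(θ); transporting it by `g` gives a horizontal lift.
  -- At the end, the invertible B† is cancelled to give `g 1 = 1`.
  let W : ℝ → Matrix (Fin n) (Fin n) ℂ := fun t => g t * Bᴴ
  have hWd : ∀ t ∈ Icc (0 : ℝ) 1, HasDerivWithinAt W
      (lyapunovConnection M.ρ (smallLoop θ h v ε t) (smallLoopDeriv h v ε t) * W t)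
      (Icc 0 1) t := fun t ht => by
    have := (hg t ht).mul_const Bᴴ
    rw [mul_assoc] at this
    exact this
  have hW0 : W 0 * (W 0)ᴴ = M.ρ θ := by
    simp only [W, hg0, one_mul, Matrix.conjTranspose_conjTranspose]
    exact hB.symm
  have hlift : ∀ t ∈ Icc (0 : ℝ) 1, W t * (W t)ᴴ = M.ρ (smallLoop θ h v ε t) :=
    M.isFaithfulFamily.mul_star_eq
      (fun t _ => (hasDerivAt_smallLoop θ h v ε t).hasDerivWithinAt)
      (by unfold smallLoopDeriv; fun_prop) (fun t ht => hrΘ (hmem t ht)) hWd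
      (by rw [smallLoop_zero]; exact hW0)
  have hWlift : IsHorizontalLift (M.stateCurve γ) W := by
    refine ⟨fun t ht => (hWd t ht).continuousWithinAt, fun t ht => ?_, ∅, fun t ht _ => ?_⟩
    · rw [stateCurve, hcurve t ht, hlift t ht]
    · have ht' := Ioo_subset_Icc_self ht
      have hnhds := Icc_mem_nhds ht.1 ht.2
      have hγd : HasDerivAt (M.curve γ) (smallLoopDeriv h v ε t) t :=
        (hasDerivAt_smallLoop θ h v ε t).congr_of_eventuallyEq
          (by filter_upwards [hnhds] with s hs using hcurve s hs)
      rw [half_smul_sld_stateCurve γ hγd]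
      have := (hWd t ht').hasDerivAt hnhds
      rw [← hcurve t ht'] at this
      exact this
  have hrpf := H x γ hC1 hhom W hWlift
  have hW1 := hlift 1 (by simp)
  rw [smallLoop_one] at hW1
  rw [isRelativePhaseFactor_one_iff (hW0 ▸ M.posDef_ρ θ hθ) (hW1.trans hW0.symm)] at hrpf
  have hBu : IsUnit Bᴴ := by
    have := (M.posDef_ρ θ hθ).isUnit
    rw [hB, Matrix.isUnit_iff_isUnit_det, Matrix.det_mul] at this
    exact (Matrix.isUnit_iff_isUnit_det _).2 (isUnit_of_mul_isUnit_left this)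
  simp only [W, hg0] at hrpf
  exact hBu.mul_left_injective hrpf

end Model

end QuantumEstimation

end

theorem theorem4 {n m : ℕ} (M : QuantumEstimation.Model n m) :
    (∀ θ ∈ M.Θ, M.LocallyQuasiClassicalAt θ ↔ ∀ i j : Fin m, M.F i j θ = 0) ∧
    (SimplyConnectedSpace M.Θ →
      ((∀ θ ∈ M.Θ, M.LocallyQuasiClassicalAt θ) ↔
        ∀ (x : M.Θ) (γ : Path x x), QuantumEstimation.IsPiecewiseC1 (M.curve γ) →
          QuantumEstimation.RelativePhaseFactorVanishes (M.stateCurve γ))) ∧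
    ((∀ θ ∈ M.Θ, M.LocallyQuasiClassicalAt θ) ↔
      ∀ (x : M.Θ) (γ : Path x x), QuantumEstimation.IsPiecewiseC1 (M.curve γ) →
        Path.Homotopic γ (Path.refl x) →
          QuantumEstimation.RelativePhaseFactorVanishes (M.stateCurve γ)) := by
  refine ⟨fun θ hθ => QuantumEstimation.Model.locallyQuasiClassicalAt_iff_F hθ,
    fun _ => ⟨fun h x γ hγ => ?_, fun H θ hθ => ?_⟩, fun h x γ hγ hhom => ?_, fun H θ hθ => ?_⟩
  · exact QuantumEstimation.Model.relativePhaseFactorVanishes_of_homotopic h hγ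
      (SimplyConnectedSpace.paths_homotopic γ (Path.refl x))
  -- Null-homotopic loops are among all loops.
  · exact QuantumEstimation.Model.locallyQuasiClassicalAt_of_vanishes
      (fun x γ hγ _ => H x γ hγ) hθ
  · exact QuantumEstimation.Model.relativePhaseFactorVanishes_of_homotopic h hγ hhom
  · exact QuantumEstimation.Model.locallyQuasiClassicalAt_of_vanishes H hθ
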